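/- Let $k$ be a field of characteristic zero, $q\in k$ with $q\neq 0,\pm1$, $\omega=q-q^{-1}$, and let $\mathfrak z$ be a commutative $k$-algebra that is an integral domain. Let $n\ge 1$, $A_0,\dots,A_n\in\mathfrak z$ and $p(u)=-u^{n+1}+A_0u^n+A_1u^{n-1}+\dots+A_n$, with $p(0)=A_n\neq 0$. Let $\mathcal H_p$ be the $\mathfrak z$-algebra with generators $R,K$ and relations $R^2=\omega R+1$, $RKRK=KRKR$, $p(K)=0$. Put $\mathfrak z(x)=\mathfrak z\otimes_k k(x)$, $\mathcal H_p(x)=\mathcal H_p\otimes_k k(x)$, $\mathcal H_p(x,y)=\mathcal H_p\otimes_k k(x,y)$ and $R(x)=R-x^{-1}R^{-1}$. A solution is an element $K(x)\in\mathcal H_p(x)$, polynomial in $K$ with coefficients in $\mathfrak z(x)$, such that in $\mathcal H_p(x,y)$ $$R(\tfrac xy)K(x)R(xy)K(y)=K(y)R(xy)K(x)R(\tfrac xy).$$ It is trivial if it lies in $\mathfrak z(x)$. Put $\tilde K=K^n-A_0K^{n-1}-\dots-A_{n-1}$, so that $K\tilde K=A_n$, and $\tilde K=A_nK^{-1}$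 if $K$ is invertible. A solution is small if $n>1$ and the coefficient of $K^{n-1}$ in its expansion over $1,K,\dots,K^{n-1},\tilde K$ is zero. Then: 1. Every non-trivial small solution has the form $a_+K+a_0+b\tilde K$ with $a_+,a_0,b\in\mathfrak z(x)$; in particular, if $K$ is invertible, it has the form $a_+K+a_0+a_-K^{-1}$ with $a_\pm,a_0\in\mathfrak z(x)$. 2. A non-trivial small solution can exist only for $n=3$. 3. Let $n=3$ and suppose that $-A_3$ has a square root $s=\sqrt{-A_3}$ in $\mathfrak z$. Then $$K_s(x)=x\,s\,K+\frac{A_0s+A_2x}{x-x^{-1}}+\tilde K$$ is a non-trivial small solution, where $\tilde K=A_3K^{-1}$ if $K$ is invertible. Every non-trivial small solution is equal to $f\,K_s(x)$ or to $f\,K_{-s}(x)$ for some $f\in\mathfrak z(x)$; that is, it is unique up to a factor from $\mathfrak z(x)$ and the choice of the square root of $-A_3$. -/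

import Mathlib

open scoped TensorProduct Polynomial

/-- The two generators of the (affine, cyclotomic) Hecke algebra of rank one. -/
inductive HeckeGen : Type
  | R : HeckeGen
  | K : HeckeGen

noncomputable section

namespace Baxter

/-- The defining relations, in the free algebra `𝔷⟨R, K⟩`, of the cyclotomic Hecke algebra:
the Hecke condition with `ω = q - q⁻¹`, the reflection equation, and `p(K) = 0`. -/
inductive Rel {k 𝔷 : Type*} [Field k] [CommRing 𝔷] [Algebra k 𝔷] (q : k) (p : 𝔷[X]) :
    FreeAlgebra 𝔷 HeckeGen → FreeAlgebra 𝔷 HeckeGen → Prop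
  | hecke : Rel q p (FreeAlgebra.ι 𝔷 HeckeGen.R ^ 2)
      (algebraMap k (FreeAlgebra 𝔷 HeckeGen) (q - q⁻¹) * FreeAlgebra.ι 𝔷 HeckeGen.R + 1)
  | reflection : Rel q p
      (FreeAlgebra.ι 𝔷 HeckeGen.R * FreeAlgebra.ι 𝔷 HeckeGen.K *
        FreeAlgebra.ι 𝔷 HeckeGen.R * FreeAlgebra.ι 𝔷 HeckeGen.K)
      (FreeAlgebra.ι 𝔷 HeckeGen.K * FreeAlgebra.ι 𝔷 HeckeGen.R *
        FreeAlgebra.ι 𝔷 HeckeGen.K * FreeAlgebra.ι 𝔷 HeckeGen.R)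
  | cyclotomic : Rel q p (Polynomial.aeval (FreeAlgebra.ι 𝔷 HeckeGen.K) p) 0

/-- The algebra `𝓗_p`: the quotient of `𝔷⟨R, K⟩` by the ideal of the relations above. -/
abbrev Hp {k 𝔷 : Type*} [Field k] [CommRing 𝔷] [Algebra k 𝔷] (q : k) (p : 𝔷[X]) : Type _ :=
  RingQuot (Rel q p)

/-- The generator `K` of `𝓗_p`. -/
def genK {k 𝔷 : Type*} [Field k] [CommRing 𝔷] [Algebra k 𝔷] (q : k) (p : 𝔷[X]) : Hp q p :=
  RingQuot.mkAlgHom 𝔷 (Rel q p) (FreeAlgebra.ι 𝔷 HeckeGen.K)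

/-- The image in `𝓗_p` of the generator `R`. -/
def genR' {k 𝔷 : Type*} [Field k] [CommRing 𝔷] [Algebra k 𝔷] (q : k) (p : 𝔷[X]) : Hp q p :=
  RingQuot.mkAlgHom 𝔷 (Rel q p) (FreeAlgebra.ι 𝔷 HeckeGen.R)

theorem genR'_sq {k 𝔷 : Type*} [Field k] [CommRing 𝔷] [Algebra k 𝔷] (q : k) (p : 𝔷[X]) :
    genR' q p ^ 2 = algebraMap k (Hp q p) (q - q⁻¹) * genR' q p + 1 := by
  have h := RingQuot.mkAlgHom_rel 𝔷 (Rel.hecke (q := q) (p := p))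
  rw [map_pow, map_add, map_mul, map_one] at h
  have e : RingQuot.mkAlgHom 𝔷 (Rel q p) (algebraMap k (FreeAlgebra 𝔷 HeckeGen) (q - q⁻¹)) =
      algebraMap k (Hp q p) (q - q⁻¹) := by
    rw [IsScalarTower.algebraMap_apply k 𝔷 (FreeAlgebra 𝔷 HeckeGen), AlgHom.commutes,
      ← IsScalarTower.algebraMap_apply k 𝔷]
  rw [e] at h
  exact h

/-- The generator `R` of `𝓗_p` as an invertible element; by the Hecke condition its inverse
is `R - ω`. -/
def genR {k 𝔷 : Type*} [Field k] [CommRing 𝔷] [Algebra k 𝔷] (q : k) (p : 𝔷[X]) : (Hp q p)ˣ where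
  val := genR' q p
  inv := genR' q p - algebraMap k (Hp q p) (q - q⁻¹)
  val_inv := by
    rw [mul_sub, ← sq, genR'_sq, ← Algebra.commutes]
    abel
  inv_val := by
    rw [sub_mul, ← sq, genR'_sq]
    abel

/-- `𝔷(x) = 𝔷 ⊗ k(x)`. -/
abbrev Zx (k 𝔷 : Type*) [Field k] [CommRing 𝔷] [Algebra k 𝔷] : Type _ := 𝔷 ⊗[k] RatFunc k

/-- `k(x, y)`; the variables `x`, `y` are the ones with index `0`, `1`. -/
abbrev Kxy (k : Type*) [Field k] : Type _ := FractionRing (MvPolynomial (Fin 2) k)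

/-- `𝓗_p(x) = 𝓗_p ⊗ k(x)`. -/
abbrev Hpx {k 𝔷 : Type*} [Field k] [CommRing 𝔷] [Algebra k 𝔷] (q : k) (p : 𝔷[X]) : Type _ :=
  Hp q p ⊗[k] RatFunc k

/-- `𝓗_p(x, y) = 𝓗_p ⊗ k(x, y)`. -/
abbrev Hpxy {k 𝔷 : Type*} [Field k] [CommRing 𝔷] [Algebra k 𝔷] (q : k) (p : 𝔷[X]) : Type _ :=
  Hp q p ⊗[k] Kxy k

/-- The variables `x` (index `0`) and `y` (index `1`) in `k(x, y)`. -/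
def var (k : Type*) [Field k] (i : Fin 2) : Kxy k :=
  algebraMap (MvPolynomial (Fin 2) k) (Kxy k) (MvPolynomial.X i)

theorem aeval_var_injective (k : Type*) [Field k] (i : Fin 2) :
    Function.Injective (Polynomial.aeval (R := k) (var k i)) := by
  have h : Function.Injective
      (Polynomial.aeval (R := k) (MvPolynomial.X i : MvPolynomial (Fin 2) k)) :=
    transcendental_iff_injective.1 (MvPolynomial.transcendental_X k i)
  have e : ⇑(Polynomial.aeval (R := k) (var k i)) =
      algebraMap (MvPolynomial (Fin 2) k) (Kxy k) ∘
        Polynomial.aeval (MvPolynomial.X i : MvPolynomial (Fin 2) k) := by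
    funext f
    exact Polynomial.aeval_algebraMap_apply (Kxy k) _ f
  rw [e]
  exact (IsFractionRing.injective (MvPolynomial (Fin 2) k) (Kxy k)).comp h

/-- The inclusion `k(x) → k(x, y)` that sends the variable of `k(x)` to `x` (for `i = 0`) or
to `y` (for `i = 1`). -/
def subst (k : Type*) [Field k] (i : Fin 2) : RatFunc k →ₐ[k] Kxy k :=
  RatFunc.liftAlgHom (Polynomial.aeval (var k i))
    (nonZeroDivisors_le_comap_nonZeroDivisors_of_injective _ (aeval_var_injective k i))

/-- For `K(x) ∈ 𝓗_p(x)` the elements `K(x)` (for `i = 0`) and `K(y)` (for `i = 1`)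
of `𝓗_p(x, y)`. -/
def evalAt {k 𝔷 : Type*} [Field k] [CommRing 𝔷] [Algebra k 𝔷] (q : k) (p : 𝔷[X]) (i : Fin 2) :
    Hpx q p →ₐ[k] Hpxy q p :=
  Algebra.TensorProduct.map (AlgHom.id k (Hp q p)) (subst k i)

/-- `R(t) = R - t⁻¹ R⁻¹ ∈ 𝓗_p(x, y)` for `t ∈ k(x, y)`. -/
def Rspec {k 𝔷 : Type*} [Field k] [CommRing 𝔷] [Algebra k 𝔷] (q : k) (p : 𝔷[X]) (t : Kxy k) :
    Hpxy q p :=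
  (genR q p : Hp q p) ⊗ₜ[k] (1 : Kxy k) - ((genR q p)⁻¹ : (Hp q p)ˣ).val ⊗ₜ[k] t⁻¹

/-- The reflection equation with spectral parameter in `𝓗_p(x, y)`:
`R(x/y) K(x) R(xy) K(y) = K(y) R(xy) K(x) R(x/y)`. -/
def IsSolution {k 𝔷 : Type*} [Field k] [CommRing 𝔷] [Algebra k 𝔷] (q : k) (p : 𝔷[X])
    (F : Hpx q p) : Prop :=
  Rspec q p (var k 0 / var k 1) * evalAt q p 0 F * Rspec q p (var k 0 * var k 1) * evalAt q p 1 F =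
  evalAt q p 1 F * Rspec q p (var k 0 * var k 1) * evalAt q p 0 F * Rspec q p (var k 0 / var k 1)

/-- The structure map `𝔷(x) → 𝓗_p(x)`. -/
def scal {k 𝔷 : Type*} [Field k] [CommRing 𝔷] [Algebra k 𝔷] (q : k) (p : 𝔷[X]) :
    Zx k 𝔷 →ₐ[k] Hpx q p :=
  Algebra.TensorProduct.map (IsScalarTower.toAlgHom k 𝔷 (Hp q p)) (AlgHom.id k (RatFunc k))

/-- The inclusion `𝓗_p → 𝓗_p(x)` as constant functions. -/
def const {k 𝔷 : Type*} [Field k] [CommRing 𝔷] [Algebra k 𝔷] (q : k) (p : 𝔷[X]) :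
    Hp q p →ₐ[k] Hpx q p :=
  Algebra.TensorProduct.includeLeft

/-- The solutions from `𝔷(x)` are called trivial. -/
def IsTrivial {k 𝔷 : Type*} [Field k] [CommRing 𝔷] [Algebra k 𝔷] (q : k) (p : 𝔷[X])
    (F : Hpx q p) : Prop :=
  ∃ f : Zx k 𝔷, F = scal q p f

/-- `p(u) = -u^(n+1) + A_0 u^n + A_1 u^(n-1) + ... + A_n`. Only `A 0, ..., A n` enter. -/
def poly {𝔷 : Type*} [CommRing 𝔷] (n : ℕ) (A : ℕ → 𝔷) : 𝔷[X] :=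
  -Polynomial.X ^ (n + 1) +
    ∑ i ∈ Finset.range (n + 1), Polynomial.C (A i) * Polynomial.X ^ (n - i)

/-- `K̃ = K^n - A_0 K^(n-1) - ... - A_(n-1)`, which satisfies `K K̃ = A_n`; so `K̃ = A_n K⁻¹`
whenever `K` is invertible. -/
def Ktilde {k 𝔷 : Type*} [Field k] [CommRing 𝔷] [Algebra k 𝔷] (q : k) (n : ℕ) (A : ℕ → 𝔷) :
    Hp q (poly n A) :=
  genK q (poly n A) ^ n -
    ∑ i ∈ Finset.range n, algebraMap 𝔷 (Hp q (poly n A)) (A i) * genK q (poly n A) ^ (n - 1 - i)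

/-- A solution `F`, polynomial in `K` with coefficients in `𝔷(x)`, is small if `n > 1` and the
coefficient of `K^(n-1)` vanishes in the expansion of `F` over `1, K, ..., K^(n-1), K̃`.
(These elements form a basis, so the expansion is unique.) -/
def IsSmallSolution {k 𝔷 : Type*} [Field k] [CommRing 𝔷] [Algebra k 𝔷] (q : k) (n : ℕ)
    (A : ℕ → 𝔷) (F : Hpx q (poly n A)) : Prop :=
  IsSolution q (poly n A) F ∧ 1 < n ∧
    ∃ (c : ℕ → Zx k 𝔷) (d : Zx k 𝔷),
      F = (∑ i ∈ Finset.range n,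
            scal q (poly n A) (c i) * const q (poly n A) (genK q (poly n A) ^ i)) +
          scal q (poly n A) d * const q (poly n A) (Ktilde q n A) ∧
      c (n - 1) = 0

/-- Non-trivial small solutions. -/
def IsNontrivialSmall {k 𝔷 : Type*} [Field k] [CommRing 𝔷] [Algebra k 𝔷] (q : k) (n : ℕ)
    (A : ℕ → 𝔷) (F : Hpx q (poly n A)) : Prop :=
  IsSmallSolution q n A F ∧ ¬ IsTrivial q (poly n A) F

/-- `x s K + (A_0 s + A_2 x) / (x - x⁻¹) + L`, an element of `𝓗_p(x)`, for `s ∈ 𝔷` and a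
constant `L ∈ 𝓗_p`. -/
def smallFormula {k 𝔷 : Type*} [Field k] [CommRing 𝔷] [Algebra k 𝔷] (q : k) (n : ℕ)
    (A : ℕ → 𝔷) (s : 𝔷) (L : Hp q (poly n A)) : Hpx q (poly n A) :=
  scal q (poly n A) (s ⊗ₜ[k] RatFunc.X) * const q (poly n A) (genK q (poly n A)) +
    scal q (poly n A)
      ((A 0 * s) ⊗ₜ[k] (1 / (RatFunc.X - RatFunc.X⁻¹)) +
        A 2 ⊗ₜ[k] (RatFunc.X / (RatFunc.X - RatFunc.X⁻¹))) +
    const q (poly n A) L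

end Baxter

end

/-!
Let `L = Frac 𝔷[x, y]` and `T = L[u, v] / (p(u), p(v), Δ)`, where `Δ = (p(u) - p(v)) / (u - v)`.
The generic principal series representation of `𝓗_p` acts on `T²`, with `K` triangular and `u`, `v`
on its diagonal. The lower left entry of the reflection equation in this representation is
antisymmetric under `u ↔ v`. Lifted to `L[u, v] / (p(u), p(v))`, it is an antisymmetric multiple
of `Δ`; but `(g(u) - g(v)) Δ = 0` for every `g`, so such a multiple is also symmetric and vanishes
because `2 ≠ 0`. The reflection equation thus yields a single scalar equation in
`L[u] / p(u) ⊗ L[v] / p(v)`, and comparing the coefficients of `1, u, ..., u^(n-1), ũ` in it gives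
the shape of the solutions, `n = 3` and the uniqueness.

That the explicit formula is a solution rests on the fact that `R⁻¹ K̃ R⁻¹` commutes with `K`, as
`R K R` does.
-/

noncomputable section

namespace Baxter

section FunctionField

variable (k 𝔷 : Type*) [Field k] [CommRing 𝔷]

/-- The total fraction ring of `𝔷[x, y]`, which is a field if `𝔷` is a domain. -/
abbrev FieldXY : Type _ := FractionRing (MvPolynomial (Fin 2) 𝔷)

/-- The variables `x` (index `0`) and `y` (index `1`) of `FieldXY 𝔷`. -/
def coord (i : Fin 2) : FieldXY 𝔷 :=
  algebraMap (MvPolynomial (Fin 2) 𝔷) (FieldXY 𝔷) (MvPolynomial.X i)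

variable {𝔷} in
theorem algebraMap_ne_algebraMap_of_eval_ne {P Q : MvPolynomial (Fin 2) 𝔷} (c : Fin 2 → 𝔷)
    (h : MvPolynomial.eval c P ≠ MvPolynomial.eval c Q) :
    algebraMap _ (FieldXY 𝔷) P ≠ algebraMap _ (FieldXY 𝔷) Q := fun e =>
  h (congrArg (MvPolynomial.eval c) (IsFractionRing.injective _ (FieldXY 𝔷) e))

theorem polynomial_aeval_coord_injective (i : Fin 2) :
    Function.Injective (Polynomial.aeval (R := 𝔷) (coord 𝔷 i)) := by
  have h : ⇑(Polynomial.aeval (R := 𝔷) (coord 𝔷 i)) =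
      algebraMap (MvPolynomial (Fin 2) 𝔷) (FieldXY 𝔷) ∘ Polynomial.aeval (MvPolynomial.X i) :=
    funext fun P => Polynomial.aeval_algebraMap_apply _ _ P
  rw [h]
  exact (IsFractionRing.injective _ _).comp
    (transcendental_iff_injective.1 (MvPolynomial.transcendental_X 𝔷 i))

theorem one_tmul_algebraMap [Algebra k 𝔷] (f : k[X]) : (1 : 𝔷) ⊗ₜ[k] algebraMap k[X] (RatFunc k) f =
    Polynomial.aeval ((1 : 𝔷) ⊗ₜ[k] (RatFunc.X : RatFunc k)) (f.map (algebraMap k 𝔷)) := by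
  have h : (Algebra.TensorProduct.includeRight.comp
      (IsScalarTower.toAlgHom k k[X] (RatFunc k)) : k[X] →ₐ[k] Zx k 𝔷) =
      Polynomial.aeval ((1 : 𝔷) ⊗ₜ[k] (RatFunc.X : RatFunc k)) :=
    Polynomial.algHom_ext (by simp [RatFunc.algebraMap_X])
  rw [Polynomial.aeval_map_algebraMap, ← h]
  simp

theorem exists_mul_algebraMap_eq_aeval [Algebra k 𝔷] (e : Zx k 𝔷) : ∃ g : k[X], g ≠ 0 ∧ ∃ P : 𝔷[X],
    e * (1 ⊗ₜ algebraMap k[X] (RatFunc k) g) =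
      Polynomial.aeval ((1 : 𝔷) ⊗ₜ[k] (RatFunc.X : RatFunc k)) P := by
  induction e using TensorProduct.induction_on with
  | zero => exact ⟨1, one_ne_zero, 0, by simp⟩
  | tmul a f =>
    induction f using RatFunc.induction_on with
    | f p r hr =>
      refine ⟨r, hr, Polynomial.C a * p.map (algebraMap k 𝔷), ?_⟩
      rw [map_mul, ← one_tmul_algebraMap, Polynomial.aeval_C,
        Algebra.TensorProduct.algebraMap_apply, Algebra.TensorProduct.tmul_mul_tmul,
        Algebra.TensorProduct.tmul_mul_tmul, div_mul_cancel₀ _ (RatFunc.algebraMap_ne_zero hr),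
        one_mul, Algebra.algebraMap_self_apply]
  | add e f he hf =>
    obtain ⟨g, hg, P, hP⟩ := he
    obtain ⟨h, hh, Q, hQ⟩ := hf
    refine ⟨g * h, mul_ne_zero hg hh,
      P * h.map (algebraMap k 𝔷) + Q * g.map (algebraMap k 𝔷), ?_⟩
    rw [one_tmul_algebraMap] at hP hQ ⊢
    rw [Polynomial.map_mul, map_mul, map_add, map_mul, map_mul, ← hP, ← hQ]
    ring

variable [IsDomain 𝔷]

theorem coord_ne_zero (i : Fin 2) : coord 𝔷 i ≠ 0 := by
  simpa only [coord, map_zero] using algebraMap_ne_algebraMap_of_eval_ne (Q := 0) 1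
    (P := MvPolynomial.X (R := 𝔷) i) (by simp)

theorem coord_zero_ne_coord_one : coord 𝔷 0 ≠ coord 𝔷 1 :=
  algebraMap_ne_algebraMap_of_eval_ne ![0, 1] (by simp)

theorem coord_mul_coord_ne_one (i j : Fin 2) : coord 𝔷 i * coord 𝔷 j ≠ 1 := by
  rw [coord, coord, ← map_mul, ← map_one (algebraMap (MvPolynomial (Fin 2) 𝔷) (FieldXY 𝔷))]
  exact algebraMap_ne_algebraMap_of_eval_ne 0 (by simp)

variable [Algebra k 𝔷]

theorem aeval_coord_injective :
    Function.Injective (MvPolynomial.aeval (R := k) (coord 𝔷)) := by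
  have factor : MvPolynomial.aeval (R := k) (coord 𝔷) =
      (IsScalarTower.toAlgHom k (MvPolynomial (Fin 2) 𝔷) (FieldXY 𝔷)).comp
        (MvPolynomial.mapAlgHom (σ := Fin 2) (Algebra.ofId k 𝔷)) :=
    MvPolynomial.algHom_ext fun i => by simp [coord]
  rw [factor]
  exact (IsFractionRing.injective _ _).comp
    (MvPolynomial.map_injective _ (algebraMap k 𝔷).injective)

/-- The inclusion `k(x, y) → Frac 𝔷[x, y]`. -/
def inclKxy : Kxy k →ₐ[k] FieldXY 𝔷 :=
  IsFractionRing.liftAlgHom (aeval_coord_injective k 𝔷)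

theorem inclKxy_var (i : Fin 2) : inclKxy k 𝔷 (var k i) = coord 𝔷 i := by
  simp [inclKxy, var]

theorem subst_algebraMap (i : Fin 2) (f : k[X]) :
    subst k i (algebraMap k[X] (RatFunc k) f) = Polynomial.aeval (var k i) f := by
  simpa [subst] using RatFunc.liftAlgHom_apply_div (Polynomial.aeval (R := k) (var k i))
    (nonZeroDivisors_le_comap_nonZeroDivisors_of_injective _ (aeval_var_injective k i)) f 1

theorem subst_X (i : Fin 2) : subst k i RatFunc.X = var k i := by
  rw [← RatFunc.algebraMap_X, subst_algebraMap, Polynomial.aeval_X]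

/-- The map `𝔷(x) → Frac 𝔷[x, y]` that sends the variable to the one with index `i`; the
coefficient ring analogue of `evalAt`. -/
def evalZx (i : Fin 2) : Zx k 𝔷 →ₐ[𝔷] FieldXY 𝔷 :=
  Algebra.TensorProduct.lift (Algebra.ofId 𝔷 (FieldXY 𝔷)) ((inclKxy k 𝔷).comp (subst k i))
    fun _ _ => Commute.all _ _

theorem evalZx_tmul (i : Fin 2) (a : 𝔷) (f : RatFunc k) :
    evalZx k 𝔷 i (a ⊗ₜ f) = algebraMap 𝔷 (FieldXY 𝔷) a * inclKxy k 𝔷 (subst k i f) := by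
  simp [evalZx, Algebra.ofId_apply]

theorem evalZx_one_tmul_X (i : Fin 2) :
    evalZx k 𝔷 i (1 ⊗ₜ RatFunc.X) = coord 𝔷 i := by
  rw [evalZx_tmul, map_one, one_mul, subst_X, inclKxy_var]

theorem evalZx_injective (i : Fin 2) : Function.Injective (evalZx k 𝔷 i) := by
  rw [injective_iff_map_eq_zero]
  intro e he
  obtain ⟨g, hg, P, hP⟩ := exists_mul_algebraMap_eq_aeval k 𝔷 e
  have hP0 : Polynomial.aeval (coord 𝔷 i) P = 0 := by
    rw [← evalZx_one_tmul_X k, Polynomial.aeval_algHom_apply, ← hP, map_mul, he, zero_mul]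
  rw [(map_eq_zero_iff _ (polynomial_aeval_coord_injective 𝔷 i)).1 hP0, map_zero] at hP
  have hu : IsUnit ((1 : 𝔷) ⊗ₜ[k] algebraMap k[X] (RatFunc k) g) :=
    (RatFunc.algebraMap_ne_zero hg).isUnit.map Algebra.TensorProduct.includeRight
  exact hu.mul_left_eq_zero.1 hP

end FunctionField

section DividedDifference

variable {B T : Type*} [CommRing B] [CommRing T] [Algebra B T]

/-- The divided difference `(f(a) - f(c)) / (a - c)`, defined through `(aⁱ - cⁱ) / (a - c)`, so
that `a - c` may be a zero divisor. -/
def dividedDiff (a c : T) : B[X] →ₗ[B] T :=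
  Polynomial.lsum fun i =>
    LinearMap.toSpanSingleton B T (∑ j ∈ Finset.range i, a ^ j * c ^ (i - 1 - j))

theorem dividedDiff_monomial (a c : T) (i : ℕ) (b : B) :
    dividedDiff a c (Polynomial.monomial i b) =
      b • ∑ j ∈ Finset.range i, a ^ j * c ^ (i - 1 - j) := by
  simp [dividedDiff]

theorem dividedDiff_comm (a c : T) : dividedDiff (B := B) a c = dividedDiff c a := by
  simp only [dividedDiff, geom_sum₂_comm a c]

theorem dividedDiff_mul_sub (a c : T) (f : B[X]) :
    dividedDiff a c f * (a - c) = Polynomial.aeval a f - Polynomial.aeval c f := by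
  induction f using Polynomial.induction_on' with
  | add f g hf hg => rw [map_add, map_add, map_add, add_mul, hf, hg]; ring
  | monomial i b =>
    rw [dividedDiff_monomial, smul_mul_assoc, (Commute.all a c).geom_sum₂_mul,
      Polynomial.aeval_monomial, Polynomial.aeval_monomial, smul_sub, Algebra.smul_def,
      Algebra.smul_def]

theorem dividedDiff_X_mul (a c : T) (f : B[X]) :
    dividedDiff a c (Polynomial.X * f) = a * dividedDiff a c f + Polynomial.aeval c f := by
  induction f using Polynomial.induction_on' with
  | add f g hf hg => rw [mul_add, map_add, map_add, map_add, hf, hg]; ring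
  | monomial i b =>
    rw [Polynomial.X_mul_monomial, dividedDiff_comm, dividedDiff_monomial, dividedDiff_monomial,
      Polynomial.aeval_monomial, Nat.add_sub_cancel, (Commute.all c a).geom_sum₂_succ_eq]
    simp only [Algebra.smul_def]
    ring

theorem dividedDiff_C (a c : T) (b : B) : dividedDiff a c (Polynomial.C b) = 0 := by
  rw [← Polynomial.monomial_zero_left, dividedDiff_monomial, Finset.sum_range_zero, smul_zero]

theorem map_dividedDiff {T' : Type*} [CommRing T'] [Algebra B T'] (g : T →ₐ[B] T') (a c : T)
    (f : B[X]) : g (dividedDiff a c f) = dividedDiff (g a) (g c) f := by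
  induction f using Polynomial.induction_on' with
  | add f g hf hg => rw [map_add, map_add, map_add, hf, hg]
  | monomial i b => simp [dividedDiff_monomial]

theorem dividedDiff_map_algebraMap {B' : Type*} [CommRing B'] [Algebra B' B] [Algebra B' T]
    [IsScalarTower B' B T] (a c : T) (f : B'[X]) :
    dividedDiff a c (f.map (algebraMap B' B)) = dividedDiff a c f := by
  induction f using Polynomial.induction_on' with
  | add f g hf hg => rw [Polynomial.map_add, map_add, map_add, hf, hg]
  | monomial i b =>
    rw [Polynomial.map_monomial, dividedDiff_monomial, dividedDiff_monomial, algebraMap_smul]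

theorem aeval_triangular (a b c : T) (f : B[X]) :
    Polynomial.aeval !![a, b; 0, c] f =
      !![Polynomial.aeval a f, b * dividedDiff a c f; 0, Polynomial.aeval c f] := by
  induction f using Polynomial.induction_on with
  | C r =>
    ext i j
    fin_cases i <;> fin_cases j <;> simp [dividedDiff_C, Matrix.algebraMap_matrix_apply]
  | add f g hf hg => simp [hf, hg, mul_add]
  | monomial n r ih =>
    have hX : Polynomial.C r * Polynomial.X ^ (n + 1) =
        Polynomial.X * (Polynomial.C r * Polynomial.X ^ n) := by ring
    rw [hX, dividedDiff_X_mul]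
    simp only [map_mul _ Polynomial.X, ih, Polynomial.aeval_X, Matrix.mul_fin_two]
    congr 1
    ext i j
    fin_cases i <;> fin_cases j <;> simp; ring

end DividedDifference

section Generators

variable {k 𝔷 : Type*} [Field k] [CommRing 𝔷] [Algebra k 𝔷] (q : k) (p : 𝔷[X])

theorem aeval_genK : Polynomial.aeval (genK q p) p = 0 := by
  have h := RingQuot.mkAlgHom_rel 𝔷 (Rel.cyclotomic (q := q) (p := p))
  rwa [map_zero, ← Polynomial.aeval_algHom_apply] at h

theorem genR'_mul_genK : genR' q p * genK q p * genR' q p * genK q p =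
    genK q p * genR' q p * genK q p * genR' q p := by
  have h := RingQuot.mkAlgHom_rel 𝔷 (Rel.reflection (q := q) (p := p))
  simp only [map_mul] at h
  exact h

/-- The element `P(K)` of `𝓗_p(x)` for a polynomial `P` over `𝔷(x)`. -/
def evalGenK (P : (Zx k 𝔷)[X]) : Hpx q p :=
  P.eval₂ (scal q p : Zx k 𝔷 →+* Hpx q p) (const q p (genK q p))

end Generators

section Representation

variable {k 𝔷 : Type*} [Field k] [CommRing 𝔷] [Algebra k 𝔷] (q : k) (p : 𝔷[X])

section Lift

variable {M : Type*} [Ring M] [Algebra 𝔷 M] [Algebra k M] [IsScalarTower k 𝔷 M]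

/-- The universal property of `𝓗_p`: images `r` and `κ` of the generators that satisfy the
relations extend to an algebra homomorphism. -/
def liftHp (r κ : M) (hecke : r ^ 2 = algebraMap k M (q - q⁻¹) * r + 1)
    (reflection : r * κ * r * κ = κ * r * κ * r) (cyclotomic : Polynomial.aeval κ p = 0) :
    Hp q p →ₐ[𝔷] M :=
  RingQuot.liftAlgHom 𝔷 ⟨FreeAlgebra.lift 𝔷 (fun g => HeckeGen.casesOn g r κ), by
    intro a b h
    cases h with
    | hecke =>
      rw [IsScalarTower.algebraMap_apply k 𝔷 (FreeAlgebra 𝔷 HeckeGen)]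
      simp only [map_pow, map_add, map_mul, map_one, AlgHom.commutes, FreeAlgebra.lift_ι_apply]
      rw [hecke, IsScalarTower.algebraMap_apply k 𝔷 M]
    | reflection => simpa only [map_mul, FreeAlgebra.lift_ι_apply] using reflection
    | cyclotomic =>
      rw [← Polynomial.aeval_algHom_apply, FreeAlgebra.lift_ι_apply, map_zero]
      exact cyclotomic⟩

variable {q p} {r κ : M} (hecke : r ^ 2 = algebraMap k M (q - q⁻¹) * r + 1)
  (reflection : r * κ * r * κ = κ * r * κ * r) (cyclotomic : Polynomial.aeval κ p = 0)

theorem liftHp_genK : liftHp q p r κ hecke reflection cyclotomic (genK q p) = κ := by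
  rw [liftHp, genK, RingQuot.liftAlgHom_mkAlgHom_apply, FreeAlgebra.lift_ι_apply]

theorem liftHp_genR' : liftHp q p r κ hecke reflection cyclotomic (genR' q p) = r := by
  rw [liftHp, genR', RingQuot.liftAlgHom_mkAlgHom_apply, FreeAlgebra.lift_ι_apply]

end Lift

variable {T : Type*} [CommRing T] [Algebra k T] [Algebra 𝔷 T] [IsScalarTower k 𝔷 T]

variable {p} in
/-- The two-dimensional principal series representation of `𝓗_p` with parameters `u`, `v`. The
second condition on them is `(p(v) - p(u)) / (v - u) = 0`. -/
def principalSeries (u v : T) (hu : Polynomial.aeval u p = 0) (huv : dividedDiff v u p = 0) :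
    Hp q p →ₐ[𝔷] Matrix (Fin 2) (Fin 2) T :=
  liftHp q p !![0, 1; 1, algebraMap k T (q - q⁻¹)] !![v, -(algebraMap k T (q - q⁻¹) * u); 0, u]
    (by
      rw [sq, Matrix.mul_fin_two, Matrix.algebraMap_eq_diagonal]
      ext i j
      fin_cases i <;> fin_cases j <;> simp [Matrix.mul_apply, Fin.sum_univ_two]; ring)
    (by
      simp only [Matrix.mul_fin_two]
      ext i j
      fin_cases i <;> fin_cases j <;> simp <;> ring)
    (by
      have hv : Polynomial.aeval v p = 0 := by
        simpa only [huv, hu, zero_mul, sub_zero, eq_comm] using dividedDiff_mul_sub v u p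
      rw [aeval_triangular, hu, hv, huv]
      ext i j
      fin_cases i <;> fin_cases j <;> simp)

end Representation

section ExtendScalars

variable {k 𝔷 M : Type*} [Field k] [CommRing 𝔷] [IsDomain 𝔷] [Algebra k 𝔷] [Ring M]
  [Algebra k M] [Algebra 𝔷 M] [Algebra (FieldXY 𝔷) M] [IsScalarTower k (FieldXY 𝔷) M]
  {q : k} {p : 𝔷[X]}

/-- The extension of a homomorphism from `𝓗_p` to `𝓗_p(x, y)`. -/
def extendScalars [IsScalarTower k 𝔷 M] (ρ : Hp q p →ₐ[𝔷] M) : Hpxy q p →ₐ[k] M :=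
  Algebra.TensorProduct.lift (ρ.restrictScalars k)
    ((IsScalarTower.toAlgHom k (FieldXY 𝔷) M).comp (inclKxy k 𝔷))
    fun a f => Algebra.commute_algebraMap_right (inclKxy k 𝔷 f) (ρ a)

variable [IsScalarTower k 𝔷 M] (ρ : Hp q p →ₐ[𝔷] M)

theorem extendScalars_tmul (h : Hp q p) (f : Kxy k) :
    extendScalars ρ (h ⊗ₜ f) = ρ h * algebraMap (FieldXY 𝔷) M (inclKxy k 𝔷 f) :=
  Algebra.TensorProduct.lift_tmul _ _ _ _ _

theorem extendScalars_Rspec (t : Kxy k) : extendScalars ρ (Rspec q p t) = ρ (genR' q p) -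
    (inclKxy k 𝔷 t)⁻¹ • (ρ (genR' q p) - algebraMap k _ (q - q⁻¹)) := by
  have hinv : (((genR q p)⁻¹ : (Hp q p)ˣ) : Hp q p) =
      genR' q p - algebraMap k (Hp q p) (q - q⁻¹) := rfl
  rw [Rspec, map_sub, extendScalars_tmul, extendScalars_tmul, hinv, map_sub ρ,
    ← ρ.coe_restrictScalars' k, AlgHom.commutes, map_inv₀, map_one, map_one, mul_one,
    ← Algebra.commutes, ← Algebra.smul_def]
  rfl

theorem extendScalars_evalAt_const (i : Fin 2) (h : Hp q p) :
    extendScalars ρ (evalAt q p i (const q p h)) = ρ h := by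
  have : evalAt q p i (const q p h) = h ⊗ₜ 1 := by simp [evalAt, const]
  rw [this, extendScalars_tmul, map_one, map_one, mul_one]

variable [IsScalarTower 𝔷 (FieldXY 𝔷) M]

theorem extendScalars_evalAt_scal (i : Fin 2) (e : Zx k 𝔷) :
    extendScalars ρ (evalAt q p i (scal q p e)) =
      algebraMap (FieldXY 𝔷) M (evalZx k 𝔷 i e) := by
  induction e using TensorProduct.induction_on with
  | zero => simp
  | tmul a f =>
    have : evalAt q p i (scal q p (a ⊗ₜ f)) = algebraMap 𝔷 (Hp q p) a ⊗ₜ subst k i f := by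
      simp [evalAt, scal]
    rw [this, extendScalars_tmul, AlgHom.commutes, evalZx_tmul, map_mul,
      IsScalarTower.algebraMap_apply 𝔷 (FieldXY 𝔷) M]
  | add e f he hf => simp only [map_add, he, hf]

theorem extendScalars_evalAt_evalGenK (i : Fin 2) (P : (Zx k 𝔷)[X]) :
    extendScalars ρ (evalAt q p i (evalGenK q p P)) =
      Polynomial.aeval (ρ (genK q p)) (P.map (evalZx k 𝔷 i : Zx k 𝔷 →+* FieldXY 𝔷)) := by
  rw [Polynomial.aeval_def, Polynomial.eval₂_map, ← extendScalars_evalAt_const ρ i]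
  exact (Polynomial.hom_eval₂ P (scal q p : Zx k 𝔷 →+* Hpx q p)
    ((extendScalars ρ).comp (evalAt q p i) : Hpx q p →+* M) (const q p (genK q p))).trans
    (congrArg (Polynomial.eval₂ · _ P) (RingHom.ext (extendScalars_evalAt_scal ρ i)))

end ExtendScalars

section ReflectionIdentity

theorem lower_left_entry_reflection {T : Type*} [CommRing T] {w fu fv gu gv h h' r s : T}
    (hw : IsUnit w)
    (e : !![r * w, 1 - r; 1 - r, w] * !![fv, -(w * (h + fu)); 0, fu] *
        !![s * w, 1 - s; 1 - s, w] * !![gv, -(w * h'); 0, gu] =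
      !![gv, -(w * h'); 0, gu] * !![s * w, 1 - s; 1 - s, w] *
        !![fv, -(w * (h + fu)); 0, fu] * !![r * w, 1 - r; 1 - r, w]) :
    (1 - r) * (1 - s) * ((gu - gv) * h) + r * (1 - s) * (fu * gv - gu * fv) +
      s * (1 - r) * (fv * gv - fu * gu) = 0 := by
  have h10 := congrFun (congrFun e 1) 0
  simp only [Matrix.mul_fin_two, Matrix.of_apply, Matrix.cons_val', Matrix.cons_val_zero,
    Matrix.cons_val_one, Matrix.cons_val_fin_one] at h10
  refine hw.mul_left_cancel ?_
  linear_combination h10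

variable {k 𝔷 T : Type*} [Field k] [CommRing 𝔷] [IsDomain 𝔷] [Algebra k 𝔷] [CommRing T]
  [Algebra k T] [Algebra 𝔷 T] [IsScalarTower k 𝔷 T] [Algebra (FieldXY 𝔷) T]
  [IsScalarTower k (FieldXY 𝔷) T] {q : k} {p : 𝔷[X]} {u v : T}

theorem extendScalars_principalSeries_Rspec (hu : Polynomial.aeval u p = 0)
    (huv : dividedDiff v u p = 0) (t : Kxy k) :
    extendScalars (principalSeries q u v hu huv) (Rspec q p t) =
      let w := algebraMap k T (q - q⁻¹)
      let r := algebraMap (FieldXY 𝔷) T (inclKxy k 𝔷 t)⁻¹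
      !![r * w, 1 - r; 1 - r, w] := by
  rw [extendScalars_Rspec, principalSeries, liftHp_genR', Algebra.smul_def,
    Matrix.algebraMap_eq_diagonal, Matrix.algebraMap_eq_diagonal]
  ext i j
  fin_cases i <;> fin_cases j <;> simp [-map_sub]

variable [IsScalarTower 𝔷 (FieldXY 𝔷) T]

theorem extendScalars_principalSeries_evalGenK (hu : Polynomial.aeval u p = 0)
    (huv : dividedDiff v u p = 0) (i : Fin 2) (P : (Zx k 𝔷)[X]) :
    extendScalars (principalSeries q u v hu huv) (evalAt q p i (evalGenK q p P)) =
      let F := P.map (evalZx k 𝔷 i : Zx k 𝔷 →+* FieldXY 𝔷)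
      !![Polynomial.aeval v F, -(algebraMap k T (q - q⁻¹) * (u * dividedDiff v u F));
        0, Polynomial.aeval u F] := by
  rw [extendScalars_evalAt_evalGenK, principalSeries, liftHp_genK, aeval_triangular]
  simp only [neg_mul, mul_assoc]

theorem principalSeries_reflection (hq : q - q⁻¹ ≠ 0) {P : (Zx k 𝔷)[X]}
    (hP : IsSolution q p (evalGenK q p P)) (hu : Polynomial.aeval u p = 0)
    (huv : dividedDiff v u p = 0) :
    let x := coord 𝔷 0
    let y := coord 𝔷 1
    let F := P.map (evalZx k 𝔷 0 : Zx k 𝔷 →+* FieldXY 𝔷)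
    let G := P.map (evalZx k 𝔷 1 : Zx k 𝔷 →+* FieldXY 𝔷)
    ((x - y) * (x * y - 1)) • ((Polynomial.aeval u G - Polynomial.aeval v G) *
        (u * dividedDiff v u F - Polynomial.aeval u F)) +
      (y * (x * y - 1)) • (Polynomial.aeval u F * Polynomial.aeval v G -
        Polynomial.aeval u G * Polynomial.aeval v F) +
      (x - y) • (Polynomial.aeval v F * Polynomial.aeval v G -
        Polynomial.aeval u F * Polynomial.aeval u G) = 0 := by
  intro x y F G
  have h := congrArg (extendScalars (principalSeries q u v hu huv)) hP
  simp only [map_mul, extendScalars_principalSeries_Rspec, map_div₀, inclKxy_var,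
    extendScalars_principalSeries_evalGenK] at h
  rw [← sub_add_cancel (u * dividedDiff v u F) (Polynomial.aeval u F)] at h
  have hx : x ≠ 0 := coord_ne_zero 𝔷 0
  have hy : y ≠ 0 := coord_ne_zero 𝔷 1
  have entry := congrArg (algebraMap (FieldXY 𝔷) T (x ^ 2 * y) * ·)
    (lower_left_entry_reflection (hq.isUnit.map (algebraMap k T)) h)
  have h₁ : (x - y) * (x * y - 1) = x ^ 2 * y * ((1 - (x / y)⁻¹) * (1 - (x * y)⁻¹)) := by
    field_simp
  have h₂ : y * (x * y - 1) = x ^ 2 * y * ((x / y)⁻¹ * (1 - (x * y)⁻¹)) := by field_simp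
  have h₃ : x - y = x ^ 2 * y * ((x * y)⁻¹ * (1 - (x / y)⁻¹)) := by field_simp
  simp only [Algebra.smul_def]
  rw [h₁, h₂, h₃]
  simp only [map_mul, map_sub, map_one] at entry ⊢
  linear_combination entry

end ReflectionIdentity

section TensorSquare

variable {B : Type*} [CommRing B] (f : B[X])

/-- The algebra `B[u, v] / (f(u), f(v))`. -/
abbrev TensorSq : Type _ := AdjoinRoot f ⊗[B] AdjoinRoot f

/-- The variable `u` of `B[u, v] / (f(u), f(v))`. -/
abbrev leftRoot : TensorSq f := AdjoinRoot.root f ⊗ₜ 1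

/-- The variable `v` of `B[u, v] / (f(u), f(v))`. -/
abbrev rightRoot : TensorSq f := 1 ⊗ₜ AdjoinRoot.root f

/-- The exchange of `u` and `v` in `B[u, v] / (f(u), f(v))`. -/
abbrev swap : TensorSq f ≃ₐ[B] TensorSq f :=
  Algebra.TensorProduct.comm B (AdjoinRoot f) (AdjoinRoot f)

/-- The divided difference `(f(u) - f(v)) / (u - v)` in `B[u, v] / (f(u), f(v))`. -/
def discr : TensorSq f := dividedDiff (leftRoot f) (rightRoot f) f

/-- The symmetric element `(v P(u) - u P(v)) / (u - v)` of `B[u, v] / (f(u), f(v))`, written as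
`u (P(u) - P(v)) / (u - v) - P(u)`. -/
def twist : B[X] →ₗ[B] TensorSq f :=
  LinearMap.mulLeft B (leftRoot f) ∘ₗ
      dividedDiff (leftRoot f) (rightRoot f) -
    (Polynomial.aeval (leftRoot f)).toLinearMap

variable {f}

theorem swap_tmul (a b : AdjoinRoot f) : swap f (a ⊗ₜ b) = b ⊗ₜ a :=
  rfl

theorem aeval_leftRoot (P : B[X]) :
    Polynomial.aeval (leftRoot f) P = AdjoinRoot.mk f P ⊗ₜ 1 := by
  rw [← AdjoinRoot.aeval_eq]
  exact Polynomial.aeval_algHom_apply (Algebra.TensorProduct.includeLeft :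
    AdjoinRoot f →ₐ[B] TensorSq f) _ P

theorem aeval_rightRoot (P : B[X]) :
    Polynomial.aeval (rightRoot f) P = 1 ⊗ₜ AdjoinRoot.mk f P := by
  rw [← AdjoinRoot.aeval_eq]
  exact Polynomial.aeval_algHom_apply (Algebra.TensorProduct.includeRight :
    AdjoinRoot f →ₐ[B] TensorSq f) _ P

theorem swap_dividedDiff (P : B[X]) :
    swap f (dividedDiff (leftRoot f) (rightRoot f) P) =
    dividedDiff (leftRoot f) (rightRoot f) P := by
  have h := map_dividedDiff (swap f : TensorSq f →ₐ[B] TensorSq f) (leftRoot f) (rightRoot f) P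
  simp only [AlgEquiv.coe_toAlgHom, swap_tmul] at h
  rw [h, dividedDiff_comm]

theorem twist_apply (P : B[X]) : twist f P = (leftRoot f) *
      dividedDiff (leftRoot f) (rightRoot f) P -
    AdjoinRoot.mk f P ⊗ₜ 1 := by
  simp [twist, aeval_leftRoot]

theorem swap_twist (P : B[X]) :
    swap f (twist f P) = twist f P := by
  have h := dividedDiff_mul_sub (leftRoot f)
    (rightRoot f) P
  rw [aeval_leftRoot, aeval_rightRoot] at h
  rw [twist_apply, map_sub, map_mul, swap_dividedDiff, swap_tmul, swap_tmul]
  linear_combination -h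

theorem tmul_one_sub_one_tmul_mul_discr (a : AdjoinRoot f) :
    (a ⊗ₜ 1 - 1 ⊗ₜ a) * discr f = 0 := by
  have hroot : discr f * (leftRoot f - rightRoot f) = 0 := by
    rw [discr, dividedDiff_mul_sub, aeval_leftRoot, aeval_rightRoot, AdjoinRoot.mk_self,
      TensorProduct.zero_tmul, TensorProduct.tmul_zero, sub_zero]
  obtain ⟨P, rfl⟩ := AdjoinRoot.mk_surjective a
  rw [← aeval_leftRoot, ← aeval_rightRoot, ← dividedDiff_mul_sub, mul_assoc,
    mul_comm _ (discr f), hroot, mul_zero]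

theorem discr_mul_swap (z : TensorSq f) :
    discr f * swap f z = discr f * z := by
  induction z using TensorProduct.induction_on with
  | zero => rw [map_zero]
  | tmul a b =>
    have ha := tmul_one_sub_one_tmul_mul_discr a
    have hb := tmul_one_sub_one_tmul_mul_discr b
    have hab : a ⊗ₜ[B] b = (a ⊗ₜ 1) * (1 ⊗ₜ b) := by simp
    have hba : b ⊗ₜ[B] a = (b ⊗ₜ 1) * (1 ⊗ₜ a) := by simp
    rw [swap_tmul, hab, hba]
    linear_combination (1 ⊗ₜ[B] a) * hb - (1 ⊗ₜ[B] b) * ha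
  | add a b ha hb => rw [map_add, mul_add, mul_add, ha, hb]

theorem eq_zero_of_mem_span_discr_of_swap_eq_neg (h2 : IsUnit (2 : B)) {z : TensorSq f}
    (hz : z ∈ Ideal.span {discr f})
    (h : swap f z = -z) : z = 0 := by
  obtain ⟨w, rfl⟩ := Ideal.mem_span_singleton'.1 hz
  have hdiscr : swap f (discr f) = discr f := swap_dividedDiff f
  rw [mul_comm, map_mul, hdiscr, discr_mul_swap, eq_neg_iff_add_eq_zero, ← two_smul B,
    h2.smul_eq_zero] at h
  rw [mul_comm, h]

variable (f) in
/-- The left hand side minus the right hand side of the scalar equation in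
`B[u, v] / (f(u), f(v))` to which the reflection equation for `K(x) = F(K)` and `K(y) = G(K)`
amounts. -/
def reflectionDefect (x y : B) (F G : B[X]) : TensorSq f :=
  ((x - y) * (x * y - 1)) •
      ((AdjoinRoot.mk f G ⊗ₜ 1 - 1 ⊗ₜ AdjoinRoot.mk f G) * twist f F) +
    (y * (x * y - 1)) •
      (AdjoinRoot.mk f F ⊗ₜ AdjoinRoot.mk f G - AdjoinRoot.mk f G ⊗ₜ AdjoinRoot.mk f F) +
    (x - y) • (1 ⊗ₜ AdjoinRoot.mk f (F * G) - AdjoinRoot.mk f (F * G) ⊗ₜ 1)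

theorem swap_reflectionDefect (x y : B) (F G : B[X]) :
    swap f (reflectionDefect f x y F G) =
      -reflectionDefect f x y F G := by
  simp only [reflectionDefect, map_add, map_smul, map_mul _ _ (twist f F), map_sub, swap_twist,
    swap_tmul]
  rw [← neg_sub (AdjoinRoot.mk f G ⊗ₜ 1), neg_mul]
  module

theorem map_reflectionDefect {T : Type*} [CommRing T] [Algebra B T] (φ : TensorSq f →ₐ[B] T)
    (x y : B) (F G : B[X]) : φ (reflectionDefect f x y F G) =
      let u := φ (leftRoot f)
      let v := φ (rightRoot f)
      ((x - y) * (x * y - 1)) • ((Polynomial.aeval u G - Polynomial.aeval v G) *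
          (u * dividedDiff v u F - Polynomial.aeval u F)) +
        (y * (x * y - 1)) • (Polynomial.aeval u F * Polynomial.aeval v G -
          Polynomial.aeval u G * Polynomial.aeval v F) +
        (x - y) • (Polynomial.aeval v F * Polynomial.aeval v G -
          Polynomial.aeval u F * Polynomial.aeval u G) := by
  simp only [dividedDiff_comm (φ (rightRoot f)), Polynomial.aeval_algHom_apply, aeval_leftRoot,
    aeval_rightRoot, ← map_dividedDiff, ← map_mul, ← map_sub, ← map_smul, ← map_add,
    Algebra.TensorProduct.tmul_mul_tmul, mul_one, one_mul]
  rw [reflectionDefect, twist_apply, map_mul]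

end TensorSquare

section ReflectionDefect

variable {k 𝔷 : Type*} [Field k] [CommRing 𝔷] [IsDomain 𝔷] [Algebra k 𝔷] {q : k} {p : 𝔷[X]}

variable (p) in
/-- The polynomial `-p` over the field `Frac 𝔷[x, y]`; the sign makes it monic for
`p = poly n A`. -/
def negPoly : (FieldXY 𝔷)[X] := -p.map (algebraMap 𝔷 (FieldXY 𝔷))

theorem reflectionDefect_eq_zero (h2 : (2 : k) ≠ 0) (hq : q - q⁻¹ ≠ 0) {P : (Zx k 𝔷)[X]}
    (hP : IsSolution q p (evalGenK q p P)) :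
    reflectionDefect (negPoly p) (coord 𝔷 0) (coord 𝔷 1)
      (P.map (evalZx k 𝔷 0 : Zx k 𝔷 →+* FieldXY 𝔷))
      (P.map (evalZx k 𝔷 1 : Zx k 𝔷 →+* FieldXY 𝔷)) = 0 := by
  have h2' : IsUnit (2 : FieldXY 𝔷) := by
    simpa only [map_ofNat] using h2.isUnit.map (algebraMap k (FieldXY 𝔷))
  refine eq_zero_of_mem_span_discr_of_swap_eq_neg h2' ?_ (swap_reflectionDefect _ _ _ _)
  let φ := Ideal.Quotient.mkₐ (FieldXY 𝔷) (Ideal.span {discr (negPoly p)})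
  have hp : p.map (algebraMap 𝔷 (FieldXY 𝔷)) = -negPoly p := (neg_neg _).symm
  have hu : Polynomial.aeval (φ (leftRoot _)) p = 0 := by
    rw [← Polynomial.aeval_map_algebraMap (FieldXY 𝔷), hp, map_neg,
      Polynomial.aeval_algHom_apply, aeval_leftRoot, AdjoinRoot.mk_self,
      TensorProduct.zero_tmul, map_zero, neg_zero]
  have huv : dividedDiff (φ (rightRoot _)) (φ (leftRoot _)) p = 0 := by
    rw [dividedDiff_comm, ← dividedDiff_map_algebraMap (B := FieldXY 𝔷), hp, map_neg,
      ← map_dividedDiff, neg_eq_zero]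
    exact Ideal.Quotient.eq_zero_iff_mem.2 (Ideal.mem_span_singleton_self _)
  rw [← Ideal.Quotient.eq_zero_iff_mem, ← Ideal.Quotient.mkₐ_eq_mk (FieldXY 𝔷)]
  exact (map_reflectionDefect φ _ _ _ _).trans (principalSeries_reflection hq hP hu huv)

end ReflectionDefect

section TildePoly

variable {B : Type*} [CommRing B] (n : ℕ) (A : ℕ → B)

/-- The polynomial `u^n - A_0 u^(n-1) - ... - A_(n-1)`, whose value at `K` is `K̃`. -/
def tildePoly : B[X] :=
  Polynomial.X ^ n - ∑ i ∈ Finset.range n, Polynomial.C (A i) * Polynomial.X ^ (n - 1 - i)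

theorem X_mul_tildePoly : Polynomial.X * tildePoly n A = Polynomial.C (A n) - poly n A := by
  have h : ∑ i ∈ Finset.range n, Polynomial.C (A i) * Polynomial.X ^ (n - i) =
      Polynomial.X * ∑ i ∈ Finset.range n, Polynomial.C (A i) * Polynomial.X ^ (n - 1 - i) := by
    rw [Finset.mul_sum]
    refine Finset.sum_congr rfl fun i hi => ?_
    rw [show n - i = n - 1 - i + 1 by have := Finset.mem_range.1 hi; omega, pow_succ]
    ring
  rw [tildePoly, poly, Finset.sum_range_succ, h, Nat.sub_self]
  ring

theorem poly_eval_zero : (poly n A).eval 0 = A n := by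
  have h := congrArg (Polynomial.eval 0) (X_mul_tildePoly n A)
  rw [Polynomial.eval_mul, Polynomial.eval_X, zero_mul, Polynomial.eval_sub,
    Polynomial.eval_C] at h
  exact (sub_eq_zero.1 h.symm).symm

variable {n A} in
theorem mul_aeval_tildePoly {M : Type*} [Ring M] [Algebra B M] {κ : M}
    (hκ : Polynomial.aeval κ (poly n A) = 0) :
    κ * Polynomial.aeval κ (tildePoly n A) = algebraMap B M (A n) := by
  simpa [hκ] using congrArg (Polynomial.aeval κ) (X_mul_tildePoly n A)

/-- The polynomial whose value at `K` has the coefficients `c 0, ..., c (n - 1)` and `d` with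
respect to `1, K, ..., K^(n-1), K̃`. -/
def tildeComb (c : ℕ → B) (d : B) : B[X] :=
  ∑ j ∈ Finset.range n, c j • Polynomial.X ^ j + d • tildePoly n A

theorem map_tildePoly {B' : Type*} [CommRing B'] (g : B →+* B') :
    (tildePoly n A).map g = tildePoly n (g ∘ A) := by
  simp [tildePoly, Polynomial.map_sum]

theorem map_tildeComb {B' : Type*} [CommRing B'] (g : B →+* B') (c : ℕ → B) (d : B) :
    (tildeComb n A c d).map g = tildeComb n (g ∘ A) (g ∘ c) (g d) := by
  simp [tildeComb, Polynomial.map_sum, Polynomial.map_smul, map_tildePoly]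

theorem negPoly_poly {𝔷 : Type*} [CommRing 𝔷] (A : ℕ → 𝔷) :
    negPoly (poly n A) = -poly n (algebraMap 𝔷 (FieldXY 𝔷) ∘ A) := by
  simp [negPoly, poly, Polynomial.map_sum]

end TildePoly

section RootAlg

variable {B : Type*} [CommRing B] (n : ℕ) (A : ℕ → B)

/-- The algebra `B[u] / p(u)`. -/
abbrev RootAlg : Type _ := AdjoinRoot (-poly n A)

/-- The image `u` of the variable in `B[u] / p(u)`. -/
abbrev root : RootAlg n A := AdjoinRoot.root (-poly n A)

/-- The element `ũ = u^n - A_0 u^(n-1) - ... - A_(n-1)` of `B[u] / p(u)`. -/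
def rootTilde : RootAlg n A := AdjoinRoot.mk (-poly n A) (tildePoly n A)

theorem aeval_root_poly : Polynomial.aeval (root n A) (poly n A) = 0 := by
  rw [← neg_eq_zero, ← map_neg, AdjoinRoot.aeval_eq, AdjoinRoot.mk_self]

theorem root_mul_rootTilde : root n A * rootTilde n A = A n • 1 := by
  rw [rootTilde, ← AdjoinRoot.aeval_eq, mul_aeval_tildePoly (aeval_root_poly n A),
    Algebra.algebraMap_eq_smul_one]

theorem rootTilde_eq : rootTilde n A =
    root n A ^ n - ∑ i ∈ Finset.range n, A i • root n A ^ (n - 1 - i) := by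
  simp [rootTilde, tildePoly, map_sum, Algebra.smul_def]

theorem mk_tildeComb (c : ℕ → B) (d : B) : AdjoinRoot.mk (-poly n A) (tildeComb n A c d) =
    ∑ j ∈ Finset.range n, c j • root n A ^ j + d • rootTilde n A := by
  simp only [rootTilde, ← AdjoinRoot.aeval_eq, tildeComb, map_add, map_sum, map_smul, map_pow,
    Polynomial.aeval_X]

theorem neg_poly_eq : -poly n A = Polynomial.X ^ (n + 1) -
    ∑ i ∈ Finset.range (n + 1), Polynomial.C (A i) * Polynomial.X ^ (n - i) := by
  rw [poly, neg_add, neg_neg, sub_eq_add_neg]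

theorem degree_sum_C_mul_X_pow_sub_lt :
    (∑ i ∈ Finset.range (n + 1), Polynomial.C (A i) * Polynomial.X ^ (n - i)).degree <
      ((n + 1 : ℕ) : WithBot ℕ) := by
  refine (Polynomial.degree_sum_le _ _).trans_lt ?_
  rw [Finset.sup_lt_iff (WithBot.bot_lt_coe _)]
  intro i _
  refine (Polynomial.degree_C_mul_X_pow_le _ _).trans_lt ?_
  exact_mod_cast (by omega : n - i < n + 1)

theorem neg_poly_monic : (-poly n A).Monic := by
  rw [neg_poly_eq]
  exact Polynomial.monic_X_pow_sub (degree_sum_C_mul_X_pow_sub_lt n A)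

theorem degree_neg_poly [Nontrivial B] : (-poly n A).degree = (n + 1 : ℕ) := by
  rw [neg_poly_eq, Polynomial.degree_sub_eq_left_of_degree_lt] <;> rw [Polynomial.degree_X_pow]
  exact degree_sum_C_mul_X_pow_sub_lt n A

/-- The coordinates on `B[u] / p(u)` with respect to the basis `1, u, ..., u^n`. -/
def monomialCoord (i : ℕ) : RootAlg n A →ₗ[B] B :=
  Polynomial.lcoeff B i ∘ₗ AdjoinRoot.modByMonicHom (neg_poly_monic n A)

/-- The coordinate of `ũ` with respect to the basis `1, u, ..., u^(n-1), ũ` of `B[u] / p(u)`. -/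
def tildeCoord : RootAlg n A →ₗ[B] B := monomialCoord n A n

/-- The coordinate of `u^i`, for `i < n`, with respect to the basis `1, u, ..., u^(n-1), ũ` of
`B[u] / p(u)`. -/
def powCoord (i : ℕ) : RootAlg n A →ₗ[B] B :=
  monomialCoord n A i - monomialCoord n A i (rootTilde n A) • tildeCoord n A

section Coordinates

variable [Nontrivial B]

theorem monomialCoord_root_pow (i : ℕ) {j : ℕ} (hj : j ≤ n) :
    monomialCoord n A i (root n A ^ j) = if j = i then 1 else 0 := by
  have h : root n A ^ j = AdjoinRoot.mk (-poly n A) (Polynomial.X ^ j) := by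
    rw [map_pow, AdjoinRoot.mk_X]
  rw [monomialCoord, LinearMap.comp_apply, h, AdjoinRoot.modByMonicHom_mk,
    (Polynomial.modByMonic_eq_self_iff (neg_poly_monic n A)).2, Polynomial.lcoeff_apply,
    Polynomial.coeff_X_pow]
  · simp only [eq_comm]
  · rw [degree_neg_poly, Polynomial.degree_X_pow]
    exact_mod_cast Nat.lt_succ_of_le hj

theorem tildeCoord_root_pow {j : ℕ} (hj : j < n) : tildeCoord n A (root n A ^ j) = 0 := by
  rw [tildeCoord, monomialCoord_root_pow n A n hj.le, if_neg hj.ne]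

theorem tildeCoord_one (hn : 0 < n) : tildeCoord n A 1 = 0 := by
  rw [← pow_zero (root n A), tildeCoord_root_pow n A hn]

theorem tildeCoord_root (hn : 1 < n) : tildeCoord n A (root n A) = 0 := by
  simpa only [pow_one] using tildeCoord_root_pow n A hn

theorem tildeCoord_rootTilde : tildeCoord n A (rootTilde n A) = 1 := by
  rw [rootTilde_eq, map_sub, map_sum, Finset.sum_eq_zero, sub_zero, tildeCoord,
    monomialCoord_root_pow n A n le_rfl, if_pos rfl]
  intro i hi
  rw [map_smul, tildeCoord_root_pow n A (by have := Finset.mem_range.1 hi; omega), smul_zero]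

theorem powCoord_root_pow (i : ℕ) {j : ℕ} (hj : j < n) :
    powCoord n A i (root n A ^ j) = if j = i then 1 else 0 := by
  rw [powCoord, LinearMap.sub_apply, LinearMap.smul_apply, tildeCoord_root_pow n A hj,
    smul_zero, sub_zero, monomialCoord_root_pow n A i hj.le]

theorem powCoord_one (hn : 0 < n) (i : ℕ) : powCoord n A i 1 = if 0 = i then 1 else 0 := by
  rw [← pow_zero (root n A), powCoord_root_pow n A i hn]

theorem powCoord_root (hn : 1 < n) (i : ℕ) :
    powCoord n A i (root n A) = if 1 = i then 1 else 0 := by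
  simpa only [pow_one] using powCoord_root_pow n A i hn

theorem powCoord_rootTilde (i : ℕ) : powCoord n A i (rootTilde n A) = 0 := by
  rw [powCoord, LinearMap.sub_apply, LinearMap.smul_apply, tildeCoord_rootTilde, smul_eq_mul,
    mul_one, sub_self]

theorem powCoord_mk_tildeComb {i : ℕ} (hi : i < n) (c : ℕ → B) (d : B) :
    powCoord n A i (AdjoinRoot.mk (-poly n A) (tildeComb n A c d)) = c i := by
  rw [mk_tildeComb, map_add, map_smul, powCoord_rootTilde, smul_zero, add_zero, map_sum,
    Finset.sum_eq_single_of_mem i (Finset.mem_range.2 hi)]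
  · rw [map_smul, powCoord_root_pow n A i hi, if_pos rfl, smul_eq_mul, mul_one]
  · intro j hj hji
    rw [map_smul, powCoord_root_pow n A i (Finset.mem_range.1 hj), if_neg hji, smul_zero]

theorem powCoord_succ_mk_tildeComb_mul_root {i : ℕ} (hi : i + 1 < n) {c : ℕ → B}
    (hc : c (n - 1) = 0) (d : B) :
    powCoord n A (i + 1) (AdjoinRoot.mk (-poly n A) (tildeComb n A c d) * root n A) = c i := by
  obtain ⟨m, rfl⟩ : ∃ m, n = m + 1 := ⟨n - 1, by omega⟩
  have h : AdjoinRoot.mk (-poly (m + 1) A) (tildeComb (m + 1) A c d) * root (m + 1) A =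
      AdjoinRoot.mk _ (tildeComb (m + 1) A (fun j => j.casesOn (d * A (m + 1)) c) 0) := by
    rw [Nat.add_sub_cancel] at hc
    rw [mk_tildeComb, mk_tildeComb, Finset.sum_range_succ, Finset.sum_range_succ', hc, zero_smul,
      add_zero, zero_smul, add_zero, add_mul, smul_mul_assoc, mul_comm (rootTilde _ _),
      root_mul_rootTilde, Finset.sum_mul, pow_zero, smul_smul]
    simp only [smul_mul_assoc, ← pow_succ]
    rfl
  rw [h, powCoord_mk_tildeComb _ _ hi]

end Coordinates

end RootAlg

section Twist

variable {B : Type*} [CommRing B]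

theorem twist_X_mul (f P : B[X]) :
    twist f (Polynomial.X * P) = leftRoot f * (twist f P + 1 ⊗ₜ AdjoinRoot.mk f P) := by
  rw [twist_apply, twist_apply, dividedDiff_X_mul, aeval_rightRoot, map_mul, AdjoinRoot.mk_X]
  have h : (AdjoinRoot.root f * AdjoinRoot.mk f P) ⊗ₜ[B] 1 =
      leftRoot f * AdjoinRoot.mk f P ⊗ₜ 1 := by simp
  rw [h]
  ring

theorem twist_one (f : B[X]) : twist f 1 = -1 := by
  rw [twist_apply, ← Polynomial.C_1, dividedDiff_C, mul_zero, zero_sub, Polynomial.C_1, map_one,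
    Algebra.TensorProduct.one_def]

theorem twist_X (f : B[X]) : twist f Polynomial.X = 0 := by
  simpa [twist_one, Algebra.TensorProduct.one_def] using twist_X_mul f 1

theorem twist_X_pow_succ (f : B[X]) (i : ℕ) : twist f (Polynomial.X ^ (i + 1)) =
    ∑ l ∈ Finset.range i, (AdjoinRoot.root f ^ (l + 1)) ⊗ₜ (AdjoinRoot.root f ^ (i - l)) := by
  induction i with
  | zero => simp [twist_X]
  | succ i ih =>
    rw [pow_succ', twist_X_mul, ih, Finset.sum_range_succ', mul_add, Finset.mul_sum]
    simp [pow_succ']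

variable {n : ℕ} {A : ℕ → B}

theorem tmul_sub_mul_twist_tildePoly (a : RootAlg n A) :
    (a ⊗ₜ 1 - 1 ⊗ₜ a) * twist (-poly n A) (tildePoly n A) =
      (a ⊗ₜ 1 - 1 ⊗ₜ a) * -(rootTilde n A ⊗ₜ 1 + 1 ⊗ₜ rootTilde n A) := by
  have h := congrArg (dividedDiff (leftRoot (-poly n A)) (rightRoot _)) (X_mul_tildePoly n A)
  rw [dividedDiff_X_mul, map_sub, dividedDiff_C, zero_sub, ← map_neg, aeval_rightRoot] at h
  rw [twist_apply, eq_sub_of_add_eq h, ← sub_eq_zero, ← mul_sub]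
  rw [← tmul_one_sub_one_tmul_mul_discr a, discr]
  congr 1
  rw [rootTilde]
  ring

end Twist

section TopCoefficient

variable {B : Type*} [CommRing B] [Nontrivial B] {n s : ℕ} {A : ℕ → B}

theorem pairing_mul_twist_X_pow (hs : s ≠ 0) (hsn : s + 2 < n) {j : ℕ} (hj : j ≤ s + 1)
    (g : RootAlg n A) :
    TensorProduct.dualDistrib B _ _ (powCoord n A (s + 2) ⊗ₜ powCoord n A s)
        ((g ⊗ₜ 1 - 1 ⊗ₜ g) * twist (-poly n A) (Polynomial.X ^ j)) =
      if j = s + 1 then powCoord n A (s + 2) (g * root n A) else 0 := by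
  cases j with
  | zero =>
    simp [twist_one, powCoord_one n A (by omega : 0 < n), hs.symm]
  | succ i =>
    have hterm (l : ℕ) (hl : l ∈ Finset.range i) :
        TensorProduct.dualDistrib B _ _ (powCoord n A (s + 2) ⊗ₜ powCoord n A s)
          ((g ⊗ₜ 1 - 1 ⊗ₜ g) * (root n A ^ (l + 1)) ⊗ₜ (root n A ^ (i - l))) =
        if i - l = s then powCoord n A (s + 2) (g * root n A ^ (l + 1)) else 0 := by
      rw [Finset.mem_range] at hl
      rw [sub_mul, Algebra.TensorProduct.tmul_mul_tmul, Algebra.TensorProduct.tmul_mul_tmul,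
        map_sub, TensorProduct.dualDistrib_apply, TensorProduct.dualDistrib_apply, one_mul, one_mul,
        powCoord_root_pow n A _ (by omega : l + 1 < n), if_neg (by omega), zero_mul, sub_zero,
        powCoord_root_pow n A _ (by omega : i - l < n), mul_ite, mul_one, mul_zero]
    rw [twist_X_pow_succ, Finset.mul_sum, map_sum, Finset.sum_congr rfl hterm]
    split_ifs with h
    · rw [Finset.sum_eq_single_of_mem 0 (Finset.mem_range.2 (by omega)), if_pos (by omega),
        zero_add, pow_one]
      intro l _ hl
      exact if_neg (by omega)
    · exact Finset.sum_eq_zero fun l _ => if_neg (by omega)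

theorem pairing_mul_twist_tildePoly (hs : s ≠ 0) (hsn : s + 2 < n) (g : RootAlg n A) :
    TensorProduct.dualDistrib B _ _ (powCoord n A (s + 2) ⊗ₜ powCoord n A s)
      ((g ⊗ₜ 1 - 1 ⊗ₜ g) * twist (-poly n A) (tildePoly n A)) = 0 := by
  rw [tmul_sub_mul_twist_tildePoly]
  simp [sub_mul, mul_add, powCoord_one n A (by omega : 0 < n), hs.symm, powCoord_rootTilde]

theorem pairing_mul_twist_tildeComb (hs : s ≠ 0) (hsn : s + 2 < n) {c : ℕ → B}
    (hc : ∀ j, s + 1 < j → j < n → c j = 0) (d : B) (g : RootAlg n A) :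
    TensorProduct.dualDistrib B _ _ (powCoord n A (s + 2) ⊗ₜ powCoord n A s)
        ((g ⊗ₜ 1 - 1 ⊗ₜ g) * twist (-poly n A) (tildeComb n A c d)) =
      c (s + 1) * powCoord n A (s + 2) (g * root n A) := by
  rw [tildeComb, map_add, map_smul, map_sum, mul_add, map_add, mul_smul_comm, map_smul,
    pairing_mul_twist_tildePoly hs hsn, smul_zero, add_zero, Finset.mul_sum, map_sum,
    Finset.sum_eq_single_of_mem (s + 1) (Finset.mem_range.2 (by omega))]
  · rw [map_smul, mul_smul_comm, map_smul, pairing_mul_twist_X_pow hs hsn le_rfl, if_pos rfl,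
      smul_eq_mul]
  · intro j hj hjs
    rw [map_smul, mul_smul_comm, map_smul]
    rcases le_or_gt j (s + 1) with h | h
    · rw [pairing_mul_twist_X_pow hs hsn h, if_neg hjs, smul_zero]
    · rw [hc j h (Finset.mem_range.1 hj), zero_smul]

theorem top_coeff_mul_top_coeff_eq_zero (hs : s ≠ 0) (hsn : s + 2 < n) {c c' : ℕ → B}
    (hc : ∀ j, s + 1 < j → j < n → c j = 0) (hc' : ∀ j, s + 1 < j → j < n → c' j = 0)
    {x y d d' : B}
    (h : reflectionDefect (-poly n A) x y (tildeComb n A c d) (tildeComb n A c' d') = 0) :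
    (x - y) * (x * y - 1) * (c (s + 1) * c' (s + 1)) = 0 := by
  have h' := congrArg
    (TensorProduct.dualDistrib B _ _ (powCoord n A (s + 2) ⊗ₜ powCoord n A s)) h
  rw [reflectionDefect, map_add, map_add, map_smul, map_smul, map_smul,
    pairing_mul_twist_tildeComb hs hsn hc,
    powCoord_succ_mk_tildeComb_mul_root n A hsn (hc' _ (by omega) (by omega))] at h'
  simpa [powCoord_one n A (by omega : 0 < n), hs.symm, powCoord_mk_tildeComb n A hsn,
    hc (s + 2) (by omega) hsn,
    hc' (s + 2) (by omega) hsn] using h'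

end TopCoefficient

section ThreeTerms

variable {B : Type*} [CommRing B] {n : ℕ} {A : ℕ → B}

/-- The polynomial `a u + b + d ũ`. -/
def threeTermPoly (n : ℕ) (A : ℕ → B) (a b d : B) : B[X] :=
  a • Polynomial.X + b • 1 + d • tildePoly n A

theorem tildeComb_eq_threeTermPoly (hn : 2 ≤ n) {c : ℕ → B} (hc : ∀ j, 2 ≤ j → j < n → c j = 0)
    (d : B) : tildeComb n A c d = threeTermPoly n A (c 1) (c 0) d := by
  rw [tildeComb, threeTermPoly, ← Finset.sum_subset (Finset.range_subset_range.2 hn),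
    Finset.sum_range_succ, Finset.sum_range_one, pow_zero, pow_one, add_comm (c 0 • _)]
  intro j hj hj2
  rw [Finset.mem_range] at hj hj2
  rw [hc j (by omega) hj, zero_smul]

theorem map_threeTermPoly {B' : Type*} [CommRing B'] (g : B →+* B') (a b d : B) :
    (threeTermPoly n A a b d).map g = threeTermPoly n (g ∘ A) (g a) (g b) (g d) := by
  simp [threeTermPoly, Polynomial.map_smul, map_tildePoly]

theorem mk_threeTermPoly (a b d : B) : AdjoinRoot.mk (-poly n A) (threeTermPoly n A a b d) =
    a • root n A + b • 1 + d • rootTilde n A := by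
  simp only [rootTilde, ← AdjoinRoot.aeval_eq, threeTermPoly, map_add, map_smul, map_one,
    Polynomial.aeval_X]

theorem tmul_sub_mul_twist_threeTermPoly (g : RootAlg n A) (a b d : B) :
    (g ⊗ₜ 1 - 1 ⊗ₜ g) * twist (-poly n A) (threeTermPoly n A a b d) =
      -((g ⊗ₜ 1 - 1 ⊗ₜ g) * (b • 1 + d • (rootTilde n A ⊗ₜ 1 + 1 ⊗ₜ rootTilde n A))) := by
  rw [threeTermPoly, map_add, map_add, map_smul, map_smul, map_smul, twist_X, twist_one, smul_zero,
    zero_add, mul_add, mul_smul_comm, mul_smul_comm, tmul_sub_mul_twist_tildePoly, mul_add,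
    mul_smul_comm, mul_smul_comm]
  simp only [Algebra.smul_def]
  ring

theorem reflectionDefect_threeTermPoly (x y a b d a' b' d' : B) :
    let γ := (x * y - 1) * (y * (a * d') - x * (a' * d))
    let e := -(x * y * (x - y) * (d * d')) • rootTilde n A ^ 2 -
      ((x - y) * (a * a')) • root n A ^ 2 +
      (x * (y ^ 2 - 1) * (a * b') - y * (x ^ 2 - 1) * (a' * b)) • root n A +
      (x * (y ^ 2 - 1) * (b' * d) - y * (x ^ 2 - 1) * (b * d')) • rootTilde n A
    reflectionDefect (-poly n A) x y (threeTermPoly n A a b d) (threeTermPoly n A a' b' d') =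
      γ • (root n A ⊗ₜ rootTilde n A - rootTilde n A ⊗ₜ root n A) + (e ⊗ₜ 1 - 1 ⊗ₜ e) := by
  intro γ e
  let c := algebraMap B (TensorSq (-poly n A))
  have hc (r : B) (z : TensorSq (-poly n A)) : r • z = c r * z := Algebra.smul_def r z
  have hleft (z : RootAlg n A) (r : B) : (r • z) ⊗ₜ[B] (1 : RootAlg n A) = c r * z ⊗ₜ 1 := by
    rw [← TensorProduct.smul_tmul', hc]
  have hright (z : RootAlg n A) (r : B) : (1 : RootAlg n A) ⊗ₜ[B] (r • z) = c r * 1 ⊗ₜ z := by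
    rw [TensorProduct.tmul_smul, hc]
  have hmkleft (r s t : B) : AdjoinRoot.mk _ (threeTermPoly n A r s t) ⊗ₜ[B] (1 : RootAlg n A) =
      c r * root n A ⊗ₜ 1 + c s + c t * rootTilde n A ⊗ₜ 1 := by
    rw [mk_threeTermPoly, TensorProduct.add_tmul, TensorProduct.add_tmul, hleft, hleft, hleft,
      ← Algebra.TensorProduct.one_def, mul_one]
  have hmkright (r s t : B) : (1 : RootAlg n A) ⊗ₜ[B] AdjoinRoot.mk _ (threeTermPoly n A r s t) =
      c r * 1 ⊗ₜ root n A + c s + c t * 1 ⊗ₜ rootTilde n A := by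
    rw [mk_threeTermPoly, TensorProduct.tmul_add, TensorProduct.tmul_add, hright, hright, hright,
      ← Algebra.TensorProduct.one_def, mul_one]
  have htmul (z w : RootAlg n A) : z ⊗ₜ[B] w = z ⊗ₜ 1 * 1 ⊗ₜ w := by simp
  have hmul (z w : RootAlg n A) : (z * w) ⊗ₜ[B] (1 : RootAlg n A) = z ⊗ₜ 1 * w ⊗ₜ 1 := by simp
  have hmul' (z w : RootAlg n A) : (1 : RootAlg n A) ⊗ₜ[B] (z * w) = 1 ⊗ₜ z * 1 ⊗ₜ w := by simp
  have hroot : root n A ⊗ₜ[B] (1 : RootAlg n A) * rootTilde n A ⊗ₜ 1 =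
      (1 : RootAlg n A) ⊗ₜ root n A * 1 ⊗ₜ rootTilde n A := by
    rw [← hmul, ← hmul', root_mul_rootTilde, hleft, hright]
  rw [reflectionDefect, tmul_sub_mul_twist_threeTermPoly, map_mul, hmul, hmul',
    htmul (AdjoinRoot.mk _ (threeTermPoly n A a b d)),
    htmul (AdjoinRoot.mk _ _) (AdjoinRoot.mk _ _), htmul (root n A) (rootTilde n A),
    htmul (rootTilde n A) (root n A)]
  simp only [e, hmkleft, hmkright, TensorProduct.add_tmul, TensorProduct.sub_tmul,
    TensorProduct.tmul_add, TensorProduct.tmul_sub, hleft, hright, sq (root n A),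
    sq (rootTilde n A), hmul, hmul', hc]
  simp only [γ, map_sub, map_mul, map_neg, map_pow, map_one]
  linear_combination
    -(c x - c y) * ((c x * c y - 1) * c a' * c d + c a * c d' + c a' * c d) * hroot

end ThreeTerms

section ThreeTermEquations

variable {B : Type*} [CommRing B] {n : ℕ} {A : ℕ → B} {x y a b d a' b' d' : B}

theorem eq_zero_and_exists_eq_smul_one [Nontrivial B] (hn : 1 < n) {γ : B} {e : RootAlg n A}
    (h : γ • (root n A ⊗ₜ rootTilde n A - rootTilde n A ⊗ₜ root n A) +
      (e ⊗ₜ 1 - 1 ⊗ₜ[B] e) = 0) :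
    γ = 0 ∧ ∃ r : B, e = r • 1 := by
  have hn0 : 0 < n := by omega
  have hγ : γ = 0 := by
    have h' := congrArg (TensorProduct.dualDistrib B _ _ (powCoord n A 1 ⊗ₜ tildeCoord n A)) h
    simpa [powCoord_root n A hn, tildeCoord_one n A hn0, tildeCoord_rootTilde, powCoord_rootTilde,
      powCoord_one n A hn0] using h'
  refine ⟨hγ, powCoord n A 0 e, ?_⟩
  rw [hγ, zero_smul, zero_add] at h
  have h' := congrArg (TensorProduct.lid B _ ∘ (powCoord n A 0).rTensor _) h
  simp only [Function.comp_apply, map_sub, LinearMap.rTensor_tmul, TensorProduct.lid_tmul,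
    powCoord_one n A hn0, if_true, one_smul, map_zero] at h'
  exact (sub_eq_zero.1 h').symm

theorem threeTermPoly_equations [Nontrivial B] (hn : 1 < n)
    (h : reflectionDefect (-poly n A) x y (threeTermPoly n A a b d)
      (threeTermPoly n A a' b' d') = 0) :
    (x * y - 1) * (y * (a * d') - x * (a' * d)) = 0 ∧
    ∃ r : B, -(x * y * (x - y) * (d * d') * A n) • rootTilde n A -
      ((x - y) * (a * a')) • root n A ^ 3 +
      (x * (y ^ 2 - 1) * (a * b') - y * (x ^ 2 - 1) * (a' * b)) • root n A ^ 2 +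
      ((x * (y ^ 2 - 1) * (b' * d) - y * (x ^ 2 - 1) * (b * d')) * A n) • 1 = r • root n A := by
  rw [reflectionDefect_threeTermPoly] at h
  obtain ⟨hγ, r, he⟩ := eq_zero_and_exists_eq_smul_one hn h
  refine ⟨hγ, r, ?_⟩
  have hroot := root_mul_rootTilde n A
  simp only [Algebra.smul_def, mul_one, map_mul _ _ (A n), neg_mul, map_neg] at he hroot ⊢
  linear_combination root n A * he + (algebraMap B _ (x * y * (x - y) * (d * d')) * rootTilde n A -
    algebraMap B _ (x * (y ^ 2 - 1) * (b' * d) - y * (x ^ 2 - 1) * (b * d'))) * hroot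

theorem threeTermPoly_equations_three [Nontrivial B] {A : ℕ → B}
    (h : reflectionDefect (-poly 3 A) x y (threeTermPoly 3 A a b d)
      (threeTermPoly 3 A a' b' d') = 0) :
    (x - y) * (x * y * (d * d') * A 3 + a * a') = 0 ∧
    x * (y ^ 2 - 1) * (a * b') - y * (x ^ 2 - 1) * (a' * b) = (x - y) * (a * a') * A 0 ∧
    (x * (y ^ 2 - 1) * (b' * d) - y * (x ^ 2 - 1) * (b * d')) * A 3 =
      (x - y) * (a * a') * A 2 := by
  obtain ⟨-, r, hr⟩ := threeTermPoly_equations (by norm_num) h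
  have hcube : root 3 A ^ 3 = rootTilde 3 A + A 0 • root 3 A ^ 2 + A 1 • root 3 A +
      A 2 • 1 := by
    simp only [rootTilde_eq, Finset.sum_range_succ, Finset.range_zero, Finset.sum_empty, zero_add,
      Nat.add_one_sub_one, Nat.sub_zero, Nat.sub_self, pow_zero, pow_one]
    abel
  rw [hcube] at hr
  have ht := congrArg (tildeCoord 3 A) hr
  have h0 := congrArg (powCoord 3 A 0) hr
  have h2 := congrArg (powCoord 3 A 2) hr
  simp only [map_add, map_sub, map_smul, smul_eq_mul, tildeCoord_rootTilde, powCoord_rootTilde,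
    tildeCoord_one 3 A (by norm_num), tildeCoord_root 3 A (by norm_num),
    tildeCoord_root_pow 3 A (by norm_num : 2 < 3), powCoord_one 3 A (by norm_num),
    powCoord_root 3 A (by norm_num), powCoord_root_pow 3 A _ (by norm_num : 2 < 3), if_true,
    OfNat.ofNat_ne_zero, OfNat.zero_ne_ofNat, OfNat.one_ne_ofNat, one_ne_zero, if_false]
    at ht h0 h2
  refine ⟨?_, ?_, ?_⟩
  · linear_combination -ht
  · linear_combination h2
  · linear_combination h0

variable [IsDomain B]

theorem mul_eq_zero_of_three_lt (hn : 3 < n) (hA : A n ≠ 0) (hx : x ≠ 0) (hy : y ≠ 0)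
    (hxy : x ≠ y) (h : reflectionDefect (-poly n A) x y (threeTermPoly n A a b d)
      (threeTermPoly n A a' b' d') = 0) : a * a' = 0 ∧ d * d' = 0 := by
  obtain ⟨-, r, hr⟩ := threeTermPoly_equations (by omega) h
  have h0 : 0 < n := by omega
  have h1 : 1 < n := by omega
  have h2 : 2 < n := by omega
  constructor
  · simpa [powCoord_rootTilde, powCoord_one n A h0, powCoord_root n A h1,
      powCoord_root_pow n A _ h2, powCoord_root_pow n A _ hn, sub_eq_zero, hxy]
      using congrArg (powCoord n A 3) hr
  · simpa [tildeCoord_rootTilde, tildeCoord_one n A h0, tildeCoord_root n A h1,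
      tildeCoord_root_pow n A h2, tildeCoord_root_pow n A hn, hx, hy, hA, sub_eq_zero, hxy]
      using congrArg (tildeCoord n A) hr

theorem mul_eq_zero_two {A : ℕ → B} (hA : A 2 ≠ 0) (hx : x ≠ 0) (hy : y ≠ 0)
    (hxy : x ≠ y) (h : reflectionDefect (-poly 2 A) x y (threeTermPoly 2 A 0 b d)
      (threeTermPoly 2 A 0 b' d') = 0) : d * d' = 0 := by
  obtain ⟨-, r, hr⟩ := threeTermPoly_equations (by norm_num) h
  simpa [tildeCoord_rootTilde, tildeCoord_one, tildeCoord_root, hx, hy, hA, sub_eq_zero, hxy]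
    using congrArg (tildeCoord 2 A) hr

variable {A₀ A₂ A₃ s e : B}

theorem exists_eq_mul_of_sq_eq_neg (hx : x ≠ 0) (hy : y ≠ 0) (hd : d ≠ 0) (hd' : d' ≠ 0)
    (hs : s ^ 2 = -A₃) (h₁ : y * (a * d') = x * (a' * d))
    (h₂ : x * y * (d * d') * A₃ + a * a' = 0) :
    ∃ e, (e = s ∨ e = -s) ∧ a = e * x * d ∧ a' = e * y * d' := by
  have hsq : a' ^ 2 = (s * y * d') ^ 2 := by
    refine mul_left_cancel₀ (mul_ne_zero hx hd) ?_
    linear_combination -a' * h₁ + y * d' * h₂ - x * d * y ^ 2 * d' ^ 2 * hs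
  obtain ⟨e, he, ha'⟩ : ∃ e, (e = s ∨ e = -s) ∧ a' = e * y * d' := by
    rcases sq_eq_sq_iff_eq_or_eq_neg.1 hsq with h | h
    · exact ⟨s, Or.inl rfl, h⟩
    · exact ⟨-s, Or.inr rfl, by rw [h]; ring⟩
  refine ⟨e, he, mul_left_cancel₀ (mul_ne_zero hy hd') ?_, ha'⟩
  rw [ha'] at h₁
  linear_combination h₁

theorem mul_sq_sub_one_eq (hx : x ≠ 0) (hxy : x ≠ y) (hd : d ≠ 0) (he : e ≠ 0)
    (hA : e ^ 2 = -A₃)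
    (h₃ : x * (y ^ 2 - 1) * (e * x * d * b') - y * (x ^ 2 - 1) * (e * y * d' * b) =
      (x - y) * (e * x * d * (e * y * d')) * A₀)
    (h₄ : (x * (y ^ 2 - 1) * (b' * d) - y * (x ^ 2 - 1) * (b * d')) * A₃ =
      (x - y) * (e * x * d * (e * y * d')) * A₂) :
    b' * (y ^ 2 - 1) = d' * (A₀ * e + A₂ * y) * y := by
  refine mul_left_cancel₀ (pow_ne_zero 2 he) (mul_left_cancel₀ (mul_ne_zero hx hd)
    (mul_left_cancel₀ (sub_ne_zero.2 hxy) ?_))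
  linear_combination e * h₃ + y * h₄ -
    y * (x * (y ^ 2 - 1) * (b' * d) - y * (x ^ 2 - 1) * (b * d')) * hA

theorem threeTermPoly_three_solution {A : ℕ → B} (hA : A 3 ≠ 0) (hs : s ^ 2 = -A 3) (hx : x ≠ 0)
    (hy : y ≠ 0) (hxy : x ≠ y) (hxy1 : x * y ≠ 1) (hd : d ≠ 0) (hd' : d' ≠ 0)
    (h : reflectionDefect (-poly 3 A) x y (threeTermPoly 3 A a b d)
      (threeTermPoly 3 A a' b' d') = 0) :
    ∃ e, (e = s ∨ e = -s) ∧ a' = e * y * d' ∧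
      b' * (y ^ 2 - 1) = d' * (A 0 * e + A 2 * y) * y := by
  obtain ⟨h₁, -⟩ := threeTermPoly_equations (by norm_num) h
  obtain ⟨h₂, h₃, h₄⟩ := threeTermPoly_equations_three h
  obtain ⟨e, he, rfl, rfl⟩ := exists_eq_mul_of_sq_eq_neg hx hy hd hd' hs
    (sub_eq_zero.1 ((mul_eq_zero.1 h₁).resolve_left (sub_ne_zero.2 hxy1)))
    ((mul_eq_zero.1 h₂).resolve_left (sub_ne_zero.2 hxy))
  have hes : e ^ 2 = -A 3 := by rcases he with rfl | rfl <;> linear_combination hs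
  have he0 : e ≠ 0 := by
    rintro rfl
    exact hA (by linear_combination hes)
  exact ⟨e, he, rfl, mul_sq_sub_one_eq hx hxy hd he0 hes h₃ h₄⟩

end ThreeTermEquations

section EvaluationAtK

variable {k 𝔷 : Type*} [Field k] [CommRing 𝔷] [Algebra k 𝔷] (q : k) (n : ℕ) (A : ℕ → 𝔷)

theorem Ktilde_eq_aeval :
    Ktilde q n A = Polynomial.aeval (genK q (poly n A)) (tildePoly n A) := by
  simp [Ktilde, tildePoly]

theorem genK_mul_Ktilde : genK q (poly n A) * Ktilde q n A = algebraMap 𝔷 _ (A n) := by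
  rw [Ktilde_eq_aeval, mul_aeval_tildePoly (aeval_genK q _)]

theorem evalGenK_tildePoly :
    evalGenK q (poly n A) (tildePoly n (algebraMap 𝔷 (Zx k 𝔷) ∘ A)) =
      const q (poly n A) (Ktilde q n A) := by
  have h : (scal q (poly n A) : Zx k 𝔷 →+* Hpx q (poly n A)).comp (algebraMap 𝔷 (Zx k 𝔷)) =
      (const q (poly n A) : Hp q (poly n A) →+* Hpx q (poly n A)).comp (algebraMap 𝔷 _) := by
    ext a
    simp [scal, const]
  rw [Ktilde_eq_aeval, ← map_tildePoly, evalGenK, Polynomial.eval₂_map, h]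
  exact (Polynomial.hom_eval₂ (tildePoly n A) (algebraMap 𝔷 (Hp q (poly n A)))
    (const q (poly n A) : Hp q (poly n A) →+* Hpx q (poly n A)) (genK q (poly n A))).symm

theorem evalGenK_tildeComb (c : ℕ → Zx k 𝔷) (d : Zx k 𝔷) :
    evalGenK q (poly n A) (tildeComb n (algebraMap 𝔷 (Zx k 𝔷) ∘ A) c d) =
      (∑ i ∈ Finset.range n,
        scal q (poly n A) (c i) * const q (poly n A) (genK q (poly n A) ^ i)) +
      scal q (poly n A) d * const q (poly n A) (Ktilde q n A) := by
  rw [← evalGenK_tildePoly]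
  simp [evalGenK, tildeComb, Polynomial.eval₂_finsetSum, Polynomial.eval₂_smul]

theorem evalGenK_threeTermPoly (a b d : Zx k 𝔷) :
    evalGenK q (poly n A) (threeTermPoly n (algebraMap 𝔷 (Zx k 𝔷) ∘ A) a b d) =
      scal q (poly n A) a * const q (poly n A) (genK q (poly n A)) + scal q (poly n A) b +
      scal q (poly n A) d * const q (poly n A) (Ktilde q n A) := by
  rw [← evalGenK_tildePoly]
  simp [evalGenK, threeTermPoly, Polynomial.eval₂_smul]

end EvaluationAtK

section SmallSolutions

variable {k 𝔷 : Type*} [Field k] [CommRing 𝔷] [IsDomain 𝔷] [Algebra k 𝔷] {q : k} {n : ℕ}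
  {A : ℕ → 𝔷}

theorem eq_zero_of_evalZx_mul_evalZx {a : Zx k 𝔷} (h : evalZx k 𝔷 0 a * evalZx k 𝔷 1 a = 0) :
    a = 0 := by
  rcases mul_eq_zero.1 h with h | h
  · exact (map_eq_zero_iff _ (evalZx_injective k 𝔷 0)).1 h
  · exact (map_eq_zero_iff _ (evalZx_injective k 𝔷 1)).1 h

theorem evalZx_comp_algebraMap_comp (i : Fin 2) :
    (evalZx k 𝔷 i : Zx k 𝔷 →+* FieldXY 𝔷) ∘ algebraMap 𝔷 (Zx k 𝔷) ∘ A =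
      algebraMap 𝔷 (FieldXY 𝔷) ∘ A :=
  funext fun j => (evalZx k 𝔷 i).commutes (A j)

variable (h2 : (2 : k) ≠ 0) (hq : q - q⁻¹ ≠ 0)

include h2 hq

theorem reflectionDefect_tildeComb_eq_zero {c : ℕ → Zx k 𝔷} {d : Zx k 𝔷}
    (h : IsSolution q (poly n A)
      (evalGenK q (poly n A) (tildeComb n (algebraMap 𝔷 (Zx k 𝔷) ∘ A) c d))) :
    reflectionDefect (-poly n (algebraMap 𝔷 (FieldXY 𝔷) ∘ A)) (coord 𝔷 0) (coord 𝔷 1)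
      (tildeComb n (algebraMap 𝔷 (FieldXY 𝔷) ∘ A) (evalZx k 𝔷 0 ∘ c) (evalZx k 𝔷 0 d))
      (tildeComb n (algebraMap 𝔷 (FieldXY 𝔷) ∘ A) (evalZx k 𝔷 1 ∘ c) (evalZx k 𝔷 1 d)) = 0 := by
  have h' := reflectionDefect_eq_zero h2 hq h
  rwa [negPoly_poly, map_tildeComb, map_tildeComb, evalZx_comp_algebraMap_comp,
    evalZx_comp_algebraMap_comp] at h'

theorem coeff_eq_zero_of_isSolution {c : ℕ → Zx k 𝔷} {d : Zx k 𝔷} (hc : c (n - 1) = 0)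
    (h : IsSolution q (poly n A)
      (evalGenK q (poly n A) (tildeComb n (algebraMap 𝔷 (Zx k 𝔷) ∘ A) c d)))
    {j : ℕ} (hj : 2 ≤ j) (hjn : j < n) : c j = 0 := by
  induction hm : n - j using Nat.strong_induction_on generalizing j with
  | h m ih =>
    obtain ⟨s, rfl⟩ : ∃ s, j = s + 1 := ⟨j - 1, by omega⟩
    by_cases hjn' : s + 2 = n
    · rwa [← hjn'] at hc
    have hvanish (i : Fin 2) (l : ℕ) (hl : s + 1 < l) (hln : l < n) :
        (evalZx k 𝔷 i ∘ c) l = 0 := by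
      rw [Function.comp_apply, ih (n - l) (by omega) (by omega) hln rfl, map_zero]
    have htop := top_coeff_mul_top_coeff_eq_zero (by omega) (by omega) (hvanish 0) (hvanish 1)
      (reflectionDefect_tildeComb_eq_zero h2 hq h)
    refine eq_zero_of_evalZx_mul_evalZx ((mul_eq_zero.1 htop).resolve_left ?_)
    exact mul_ne_zero (sub_ne_zero.2 (coord_zero_ne_coord_one 𝔷))
      (sub_ne_zero.2 (coord_mul_coord_ne_one 𝔷 0 1))

theorem reflectionDefect_threeTermPoly_eq_zero {a b d : Zx k 𝔷}
    (h : IsSolution q (poly n A)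
      (evalGenK q (poly n A) (threeTermPoly n (algebraMap 𝔷 (Zx k 𝔷) ∘ A) a b d))) :
    reflectionDefect (-poly n (algebraMap 𝔷 (FieldXY 𝔷) ∘ A)) (coord 𝔷 0) (coord 𝔷 1)
      (threeTermPoly n (algebraMap 𝔷 (FieldXY 𝔷) ∘ A) (evalZx k 𝔷 0 a) (evalZx k 𝔷 0 b)
        (evalZx k 𝔷 0 d))
      (threeTermPoly n (algebraMap 𝔷 (FieldXY 𝔷) ∘ A) (evalZx k 𝔷 1 a) (evalZx k 𝔷 1 b)
        (evalZx k 𝔷 1 d)) = 0 := by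
  have h' := reflectionDefect_eq_zero h2 hq h
  rwa [negPoly_poly, map_threeTermPoly, map_threeTermPoly, evalZx_comp_algebraMap_comp,
    evalZx_comp_algebraMap_comp] at h'

theorem IsSmallSolution.exists_eq_evalGenK_threeTermPoly {F : Hpx q (poly n A)}
    (hF : IsSmallSolution q n A F) : ∃ a b d : Zx k 𝔷, (n = 2 → a = 0) ∧
      F = evalGenK q (poly n A) (threeTermPoly n (algebraMap 𝔷 (Zx k 𝔷) ∘ A) a b d) := by
  obtain ⟨hs, hn, c, d, rfl, hc⟩ := hF
  rw [← evalGenK_tildeComb] at hs ⊢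
  refine ⟨c 1, c 0, d, ?_, ?_⟩
  · rintro rfl
    exact hc
  · rw [tildeComb_eq_threeTermPoly hn fun _ => coeff_eq_zero_of_isSolution h2 hq hc hs]

end SmallSolutions

section SmallCoeff

variable {k 𝔷 : Type*} [Field k] [CommRing 𝔷] [Algebra k 𝔷]

variable (k) in
/-- The coefficient `(a₀ + a₂ x) / (x - x⁻¹)` of `1` in the small solution. -/
def smallCoeff (a₀ a₂ : 𝔷) : Zx k 𝔷 :=
  a₀ ⊗ₜ[k] (1 / (RatFunc.X - RatFunc.X⁻¹)) + a₂ ⊗ₜ[k] (RatFunc.X / (RatFunc.X - RatFunc.X⁻¹))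

theorem ratFunc_X_sub_inv_ne_zero : (RatFunc.X : RatFunc k) - RatFunc.X⁻¹ ≠ 0 := by
  intro h
  refine Polynomial.X_pow_sub_C_ne_zero two_pos (1 : k) (RatFunc.algebraMap_injective k ?_)
  have hX : (RatFunc.X : RatFunc k) * (RatFunc.X - RatFunc.X⁻¹) = RatFunc.X ^ 2 - 1 := by
    rw [mul_sub, mul_inv_cancel₀ RatFunc.X_ne_zero, sq]
  rw [map_sub, map_pow, RatFunc.algebraMap_X, map_one, map_one, map_zero, ← hX, h, mul_zero]

theorem smallCoeff_mul_sq_sub_one (a₀ a₂ : 𝔷) :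
    smallCoeff k a₀ a₂ * ((1 ⊗ₜ RatFunc.X) ^ 2 - 1) =
      (algebraMap 𝔷 _ a₀ + algebraMap 𝔷 _ a₂ * 1 ⊗ₜ RatFunc.X) * 1 ⊗ₜ RatFunc.X := by
  have hX : (RatFunc.X : RatFunc k) ≠ 0 := RatFunc.X_ne_zero
  have hX' := ratFunc_X_sub_inv_ne_zero (k := k)
  have hsq : ((1 : 𝔷) ⊗ₜ[k] (RatFunc.X : RatFunc k)) ^ 2 - 1 =
      1 ⊗ₜ (RatFunc.X * (RatFunc.X - RatFunc.X⁻¹)) := by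
    rw [mul_sub, mul_inv_cancel₀ hX, TensorProduct.tmul_sub, Algebra.TensorProduct.tmul_pow,
      one_pow, sq, Algebra.TensorProduct.one_def]
  have hcancel (f : RatFunc k) : f / (RatFunc.X - RatFunc.X⁻¹) *
      (RatFunc.X * (RatFunc.X - RatFunc.X⁻¹)) = f * RatFunc.X := by
    rw [mul_comm RatFunc.X (_ - _), ← mul_assoc, div_mul_cancel₀ _ hX']
  rw [hsq, smallCoeff]
  simp only [Algebra.TensorProduct.algebraMap_apply, Algebra.algebraMap_self, RingHom.id_apply,
    add_mul, Algebra.TensorProduct.tmul_mul_tmul, mul_one, one_mul, hcancel]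

variable (q : k) (n : ℕ) (A : ℕ → 𝔷)

theorem smallFormula_Ktilde (s : 𝔷) : smallFormula q n A s (Ktilde q n A) =
    evalGenK q (poly n A) (threeTermPoly n (algebraMap 𝔷 (Zx k 𝔷) ∘ A) (s ⊗ₜ RatFunc.X)
      (smallCoeff k (A 0 * s) (A 2)) 1) := by
  rw [evalGenK_threeTermPoly, map_one, one_mul, smallFormula, smallCoeff]

variable {n A} in
theorem evalGenK_threeTermPoly_eq_scal_mul_smallFormula [IsDomain 𝔷] {a b d : Zx k 𝔷} {s : 𝔷}
    (ha : evalZx k 𝔷 1 a = algebraMap 𝔷 _ s * coord 𝔷 1 * evalZx k 𝔷 1 d)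
    (hb : evalZx k 𝔷 1 b * (coord 𝔷 1 ^ 2 - 1) = evalZx k 𝔷 1 d *
      (algebraMap 𝔷 _ (A 0) * algebraMap 𝔷 _ s + algebraMap 𝔷 _ (A 2) * coord 𝔷 1) *
        coord 𝔷 1) :
    evalGenK q (poly n A) (threeTermPoly n (algebraMap 𝔷 (Zx k 𝔷) ∘ A) a b d) =
      scal q (poly n A) d * smallFormula q n A s (Ktilde q n A) := by
  have ha' : a = d * s ⊗ₜ RatFunc.X := by
    apply evalZx_injective k 𝔷 1
    rw [ha, map_mul, evalZx_tmul, subst_X, inclKxy_var, mul_comm]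
  have hb' : b = d * smallCoeff k (A 0 * s) (A 2) := by
    have h := congrArg (evalZx k 𝔷 1) (smallCoeff_mul_sq_sub_one (k := k) (A 0 * s) (A 2))
    simp only [map_mul, map_sub, map_add, map_pow, map_one, AlgHom.commutes,
      evalZx_one_tmul_X] at h
    apply evalZx_injective k 𝔷 1
    refine mul_right_cancel₀ (b := coord 𝔷 1 ^ 2 - 1) ?_ ?_
    · exact sub_ne_zero.2 (sq (coord 𝔷 1) ▸ coord_mul_coord_ne_one 𝔷 1 1)
    · rw [hb, map_mul, mul_assoc _ _ (_ - _), h]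
      ring
  rw [smallFormula_Ktilde, evalGenK_threeTermPoly, evalGenK_threeTermPoly, ha', hb', map_mul,
    map_mul, map_one, one_mul, mul_add, mul_add, mul_assoc]

end SmallCoeff

section Classification

variable {k 𝔷 : Type*} [Field k] [CommRing 𝔷] [IsDomain 𝔷] [Algebra k 𝔷] {q : k} {n : ℕ}
  {A : ℕ → 𝔷} (h2 : (2 : k) ≠ 0) (hq : q - q⁻¹ ≠ 0)

include h2 hq

theorem IsNontrivialSmall.eq_three (hA : A n ≠ 0) {F : Hpx q (poly n A)}
    (hF : IsNontrivialSmall q n A F) : n = 3 := by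
  obtain ⟨a, b, d, ha2, rfl⟩ := hF.1.exists_eq_evalGenK_threeTermPoly h2 hq
  have h := reflectionDefect_threeTermPoly_eq_zero h2 hq hF.1.1
  have hn : 1 < n := hF.1.2.1
  have hA' : (algebraMap 𝔷 (FieldXY 𝔷) ∘ A) n ≠ 0 :=
    (map_ne_zero_iff _ (FaithfulSMul.algebraMap_injective 𝔷 (FieldXY 𝔷))).2 hA
  by_contra hn3
  suffices had : a = 0 ∧ d = 0 by
    refine hF.2 ⟨b, ?_⟩
    simp [evalGenK_threeTermPoly, had]
  rcases (by omega : n = 2 ∨ 3 < n) with rfl | hn'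
  · obtain rfl := ha2 rfl
    rw [map_zero, map_zero] at h
    exact ⟨rfl, eq_zero_of_evalZx_mul_evalZx (mul_eq_zero_two hA' (coord_ne_zero 𝔷 0)
      (coord_ne_zero 𝔷 1) (coord_zero_ne_coord_one 𝔷) h)⟩
  · exact (mul_eq_zero_of_three_lt hn' hA' (coord_ne_zero 𝔷 0) (coord_ne_zero 𝔷 1)
      (coord_zero_ne_coord_one 𝔷) h).imp eq_zero_of_evalZx_mul_evalZx eq_zero_of_evalZx_mul_evalZx

theorem IsNontrivialSmall.eq_scal_mul_smallFormula (hA : A 3 ≠ 0) {F : Hpx q (poly 3 A)}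
    (hF : IsNontrivialSmall q 3 A F) {s : 𝔷} (hs : s ^ 2 = -A 3) : ∃ f : Zx k 𝔷,
      F = scal q (poly 3 A) f * smallFormula q 3 A s (Ktilde q 3 A) ∨
      F = scal q (poly 3 A) f * smallFormula q 3 A (-s) (Ktilde q 3 A) := by
  obtain ⟨a, b, d, -, rfl⟩ := hF.1.exists_eq_evalGenK_threeTermPoly h2 hq
  have h := reflectionDefect_threeTermPoly_eq_zero h2 hq hF.1.1
  have hA' : (algebraMap 𝔷 (FieldXY 𝔷) ∘ A) 3 ≠ 0 :=
    (map_ne_zero_iff _ (FaithfulSMul.algebraMap_injective 𝔷 (FieldXY 𝔷))).2 hA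
  have hs' : algebraMap 𝔷 (FieldXY 𝔷) s ^ 2 = -(algebraMap 𝔷 (FieldXY 𝔷) ∘ A) 3 := by
    rw [← map_pow, hs, map_neg, Function.comp_apply]
  have hxy := coord_zero_ne_coord_one 𝔷
  have hd : d ≠ 0 := by
    rintro rfl
    have ha : a = 0 := eq_zero_of_evalZx_mul_evalZx <| by
      simpa [sub_eq_zero, hxy] using (threeTermPoly_equations_three h).1
    exact hF.2 ⟨b, by simp [evalGenK_threeTermPoly, ha]⟩
  have hd' (i : Fin 2) : evalZx k 𝔷 i d ≠ 0 :=
    (map_ne_zero_iff _ (evalZx_injective k 𝔷 i)).2 hd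
  obtain ⟨e, rfl | rfl, ha, hb⟩ := threeTermPoly_three_solution hA' hs' (coord_ne_zero 𝔷 0)
    (coord_ne_zero 𝔷 1) hxy (coord_mul_coord_ne_one 𝔷 0 1) (hd' 0) (hd' 1) h
  · exact ⟨d, Or.inl (evalGenK_threeTermPoly_eq_scal_mul_smallFormula q ha hb)⟩
  · rw [← map_neg] at ha hb
    exact ⟨d, Or.inr (evalGenK_threeTermPoly_eq_scal_mul_smallFormula q ha hb)⟩

end Classification

section HeckeIdentities

variable {Z H : Type*} [CommRing Z] [Ring H] [Algebra Z H] {w : Z} {R K t : H}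

/-- The element `R - r R⁻¹` for an element `R` with `R² = w R + 1`, so that `R⁻¹ = R - w`. -/
def baxterize (w r : Z) (R : H) : H := R - r • (R - w • 1)

theorem commute_conj_inv {a : Z} (hR : R * R = w • R + 1) (hKt : K * t = a • 1)
    (htK : t * K = a • 1) (ht : Commute (R * K * R) t) :
    Commute ((R - w • 1) * t * (R - w • 1)) K := by
  have hinv : (R - w • 1) * R = 1 := by
    rw [sub_mul, hR, smul_mul_assoc, one_mul, add_sub_cancel_left]
  have hinv' : R * (R - w • 1) = 1 := by
    rw [mul_sub, hR, mul_smul_comm, mul_one, add_sub_cancel_left]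
  have hexch : (R - w • 1) * t * R * K = K * R * t * (R - w • 1) :=
    calc (R - w • 1) * t * R * K
      _ = (R - w • 1) * (t * (R * K * R)) * (R - w • 1) := by
          rw [mul_assoc _ (t * _), mul_assoc t, mul_assoc (R * K), hinv']
          simp only [mul_assoc, mul_one]
      _ = (R - w • 1) * R * (K * R * t * (R - w • 1)) := by
          rw [← ht.eq]
          simp only [mul_assoc]
      _ = K * R * t * (R - w • 1) := by rw [hinv, one_mul]
  calc (R - w • 1) * t * (R - w • 1) * K
    _ = (R - w • 1) * t * R * K - w • ((R - w • 1) * (t * K)) := by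
        simp only [mul_sub, sub_mul, mul_smul_comm, smul_mul_assoc, mul_one, one_mul, mul_assoc]
    _ = K * R * t * (R - w • 1) - w • (K * t * (R - w • 1)) := by
        rw [hexch, htK, hKt, mul_smul_comm, smul_mul_assoc, mul_one, one_mul]
    _ = K * ((R - w • 1) * t * (R - w • 1)) := by
        simp only [mul_sub, sub_mul, mul_smul_comm, smul_mul_assoc, mul_one, one_mul, mul_assoc]
        module

theorem conj_mul_sub_mul_conj {G : H} (htG : Commute t G)
    (hG : Commute ((R - w • 1) * t * (R - w • 1)) G) :
    R * t * R * G - G * R * t * R =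
      w • (t * R * G - G * R * t + (R * (t * G) - t * G * R)) := by
  have h := sub_eq_zero.2 hG.eq
  rw [← sub_eq_zero, ← h]
  simp only [mul_sub, sub_mul, mul_smul_comm, smul_mul_assoc, mul_one, one_mul, ← mul_assoc,
    htG.eq.symm]
  module

theorem reflection_sub_reflection {F G : H} (hFG : Commute F G) (r s : Z) :
    baxterize w r R * F * baxterize w s R * G - G * baxterize w s R * F * baxterize w r R =
      ((1 - r) * (1 - s)) • (R * F * R * G - G * R * F * R) +
      (w * r * (1 - s)) • (F * R * G - G * R * F) +
      (w * s * (1 - r)) • (R * (F * G) - F * G * R) := by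
  have hFG' := hFG.eq
  simp only [baxterize, mul_sub, sub_mul, mul_smul_comm, smul_mul_assoc, mul_one, one_mul,
    ← mul_assoc]
  rw [mul_assoc R F G, hFG']
  simp only [← mul_assoc]
  module

theorem threeTerm_conj_mul_sub_mul_conj {G : H} (a b : Z) (hR : R * R = w • R + 1)
    (hKG : Commute (R * K * R) G) (htG : Commute t G)
    (hG : Commute ((R - w • 1) * t * (R - w • 1)) G) :
    R * (a • K + b • 1 + t) * R * G - G * R * (a • K + b • 1 + t) * R =
      w • (b • (R * G - G * R) + (t * R * G - G * R * t) + (R * (t * G) - t * G * R)) := by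
  have hK : R * K * R * G = G * R * K * R := by rw [hKG.eq]; simp only [mul_assoc]
  have hRR : R * R * G - G * R * R = w • (R * G - G * R) := by
    rw [mul_assoc G, hR, add_mul, mul_add, smul_mul_assoc, mul_smul_comm, one_mul, mul_one,
      add_sub_add_right_eq_sub, smul_sub]
  have expand : R * (a • K + b • 1 + t) * R * G - G * R * (a • K + b • 1 + t) * R =
      a • (R * K * R * G - G * R * K * R) + b • (R * R * G - G * R * R) +
        (R * t * R * G - G * R * t * R) := by
    simp only [mul_add, add_mul, mul_smul_comm, smul_mul_assoc, mul_one]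
    module
  rw [expand, hK, hRR, conj_mul_sub_mul_conj htG hG]
  module

variable {A₀ A₁ A₂ A₃ : Z}

theorem commute_tilde {u : H} (hu : Commute u K)
    (ht : t = K ^ 3 - A₀ • K ^ 2 - A₁ • K - A₂ • 1) : Commute u t :=
  ht ▸ (((hu.pow_right 3).sub_right ((hu.pow_right 2).smul_right _)).sub_right
    (hu.smul_right _)).sub_right ((Commute.one_right _).smul_right _)

theorem commute_threeTerm {u : H} (hu : Commute u K) (hut : Commute u t) (a b : Z) :
    Commute u (a • K + b • 1 + t) :=
  ((hu.smul_right _).add_right ((Commute.one_right _).smul_right _)).add_right hut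

theorem tilde_sq (htK : t * K = A₃ • 1) (ht : t = K ^ 3 - A₀ • K ^ 2 - A₁ • K - A₂ • 1) :
    t * t = A₃ • K ^ 2 - (A₀ * A₃) • K - (A₁ * A₃) • 1 - A₂ • t := by
  have htK2 : t * K ^ 2 = A₃ • K := by rw [sq, ← mul_assoc, htK, smul_mul_assoc, one_mul]
  have htK3 : t * K ^ 3 = A₃ • K ^ 2 := by
    rw [pow_succ' K 2, ← mul_assoc, htK, smul_mul_assoc, one_mul]
  calc t * t = t * (K ^ 3 - A₀ • K ^ 2 - A₁ • K - A₂ • 1) := congrArg (t * ·) ht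
    _ = A₃ • K ^ 2 - (A₀ * A₃) • K - (A₁ * A₃) • 1 - A₂ • t := by
      simp only [mul_sub, mul_smul_comm, htK, htK2, htK3, mul_one]
      module

theorem tilde_mul_threeTerm (htK : t * K = A₃ • 1)
    (ht : t = K ^ 3 - A₀ • K ^ 2 - A₁ • K - A₂ • 1) (a b : Z) :
    t * (a • K + b • 1 + t) =
      A₃ • K ^ 2 - (A₀ * A₃) • K + (a * A₃ - A₁ * A₃) • 1 + (b - A₂) • t := by
  simp only [mul_add, mul_smul_comm, htK, tilde_sq htK ht, mul_one]
  module

theorem threeTerm_mul_threeTerm (hKt : K * t = A₃ • 1) (htK : t * K = A₃ • 1)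
    (ht : t = K ^ 3 - A₀ • K ^ 2 - A₁ • K - A₂ • 1) (a b a' b' : Z) :
    (a • K + b • 1 + t) * (a' • K + b' • 1 + t) =
      (a * a' + A₃) • K ^ 2 + (a * b' + a' * b - A₀ * A₃) • K +
        ((a + a') * A₃ + b * b' - A₁ * A₃) • 1 + (b + b' - A₂) • t := by
  rw [add_mul, tilde_mul_threeTerm htK ht]
  simp only [mul_add, add_mul, mul_smul_comm, smul_mul_assoc, hKt, mul_one, one_mul, ← sq]
  module

theorem reflection_threeTerm_coeffs {x x' y y' s b b' : Z} (hx : x * x' = 1) (hy : y * y' = 1)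
    (hs : s ^ 2 = -A₃) (hb : b * (x ^ 2 - 1) = (A₀ * s + A₂ * x) * x)
    (hb' : b' * (y ^ 2 - 1) = (A₀ * s + A₂ * y) * y) :
    let r := x' * y
    let r' := x' * y'
    (1 - r * r') * (b * (y * s)) + (r' - r) * (x * s * b') - (1 - r) * (A₀ * A₃) = 0 ∧
    (1 - r * r') * b + (r' - r) * b' - (1 - r) * A₂ = 0 ∧
    (1 - r') * (y * s - r * (x * s)) = 0 ∧
    (1 - r) * (A₃ + r' * (x * s * (y * s))) = 0 := by
  have inv {z z' c : Z} (hz : z * z' = 1) (hc : c * (z ^ 2 - 1) = (A₀ * s + A₂ * z) * z) :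
      (1 - z' ^ 2) * c = z' * (A₀ * s + A₂ * z) := by
    linear_combination z' ^ 2 * hc - (c * (z * z' + 1) - (A₀ * s + A₂ * z) * z') * hz
  have hb := inv hx hb
  have hb' := inv hy hb'
  refine ⟨?_, ?_, ?_, ?_⟩
  · linear_combination (y * s) * hb - x * x' * y * s * hb' - x' ^ 2 * b * y * s * hy -
      x * s * x' * y' * b' * hy - (1 - x' * y) * A₀ * hs - A₀ * s ^ 2 * (x * x' * hy + hx) -
      x * x' * y * s * A₂ * hy
  · linear_combination hb - x' * y * hb' - x' ^ 2 * b * hy - x' * y' * b' * hy -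
      x' * A₀ * s * hy + A₂ * hx - A₂ * x' * y * hy
  · linear_combination -(1 - x' * y') * y * s * hx
  · linear_combination (1 - x' * y) * (hs + s ^ 2 * (x * x' * hy + hx))

theorem reflection_threeTerm (hR : R * R = w • R + 1) (hRK : R * K * R * K = K * R * K * R)
    (hKt : K * t = A₃ • 1) (ht : t = K ^ 3 - A₀ • K ^ 2 - A₁ • K - A₂ • 1)
    {x x' y y' s b b' : Z} (hx : x * x' = 1) (hy : y * y' = 1) (hs : s ^ 2 = -A₃)
    (hb : b * (x ^ 2 - 1) = (A₀ * s + A₂ * x) * x)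
    (hb' : b' * (y ^ 2 - 1) = (A₀ * s + A₂ * y) * y) :
    let F := (x * s) • K + b • 1 + t
    let G := (y * s) • K + b' • 1 + t
    baxterize w (x' * y) R * F * baxterize w (x' * y') R * G =
      G * baxterize w (x' * y') R * F * baxterize w (x' * y) R := by
  intro F G
  have commute_G {u : H} (hu : Commute u K) : Commute u G :=
    commute_threeTerm hu (commute_tilde hu ht) _ _
  have hKt' : Commute K t := commute_tilde (Commute.refl K) ht
  have htK : t * K = A₃ • 1 := hKt'.eq ▸ hKt
  have hJK : Commute (R * K * R) K := by
    rw [Commute, SemiconjBy, hRK]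
    simp only [mul_assoc]
  have hFG : Commute F G := commute_G (commute_threeTerm (Commute.refl K) hKt' _ _).symm
  have hJ'K : Commute ((R - w • 1) * t * (R - w • 1)) K :=
    commute_conj_inv hR hKt htK (commute_tilde hJK ht)
  obtain ⟨c₁, c₂, c₃, c₄⟩ := reflection_threeTerm_coeffs hx hy hs hb hb'
  rw [← sub_eq_zero, reflection_sub_reflection hFG, threeTerm_conj_mul_sub_mul_conj _ _ hR
    (commute_G hJK) (commute_G hKt'.symm) (commute_G hJ'K), tilde_mul_threeTerm htK ht,
    threeTerm_mul_threeTerm hKt htK ht]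
  simp only [F, G, mul_add, mul_sub, add_mul, sub_mul, mul_smul_comm, smul_mul_assoc, mul_one,
    one_mul]
  linear_combination (norm := module) (w * c₁) • (R * K - K * R) + (w * c₂) • (R * t - t * R) +
    (w * c₃) • (t * R * K - K * R * t) + (w * c₄) • (R * K ^ 2 - K ^ 2 * R)

end HeckeIdentities

section ExplicitSolution

variable {k 𝔷 : Type*} [Field k] [CommRing 𝔷] [Algebra k 𝔷] (q : k) (p : 𝔷[X])

/-- The structure map `𝔷(x, y) → 𝓗_p(x, y)`. -/
def scalXY : 𝔷 ⊗[k] Kxy k →ₐ[k] Hpxy q p :=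
  Algebra.TensorProduct.map (IsScalarTower.toAlgHom k 𝔷 (Hp q p)) (AlgHom.id k (Kxy k))

theorem scalXY_commute (z : 𝔷 ⊗[k] Kxy k) (h : Hpxy q p) : Commute (scalXY q p z) h := by
  induction z using TensorProduct.induction_on with
  | zero => simp
  | add a b ha hb => simpa only [map_add] using ha.add_left hb
  | tmul a f =>
    induction h using TensorProduct.induction_on with
    | zero => simp
    | add a b ha hb => exact ha.add_right hb
    | tmul h g => simp [scalXY, Commute, SemiconjBy, Algebra.commutes, mul_comm]

/-- `𝓗_p(x, y)` as an algebra over `𝔷(x, y) = 𝔷 ⊗ k(x, y)`. -/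
abbrev algebraXY : Algebra (𝔷 ⊗[k] Kxy k) (Hpxy q p) :=
  (scalXY q p).toRingHom.toAlgebra' fun z h => (scalXY_commute q p z h).eq

attribute [local instance] algebraXY

theorem scalXY_mul (z : 𝔷 ⊗[k] Kxy k) (h : Hpxy q p) : scalXY q p z * h = z • h :=
  (Algebra.smul_def z h).symm

theorem tmul_smul_tmul (a : 𝔷) (f g : Kxy k) (h : Hp q p) :
    (a ⊗ₜ[k] f) • (h ⊗ₜ[k] g : Hpxy q p) = (a • h) ⊗ₜ (f * g) := by
  rw [← scalXY_mul]
  simp [scalXY, Algebra.smul_def]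

theorem algebraMap_smul_tmul_one (a : 𝔷) (h : Hp q p) :
    algebraMap 𝔷 (𝔷 ⊗[k] Kxy k) a • (h ⊗ₜ[k] 1 : Hpxy q p) = (a • h) ⊗ₜ 1 := by
  rw [Algebra.TensorProduct.algebraMap_apply, tmul_smul_tmul, mul_one,
    Algebra.algebraMap_self_apply]

theorem Rspec_eq_baxterize (t : Kxy k) : Rspec q p t =
    baxterize (algebraMap 𝔷 _ (algebraMap k 𝔷 (q - q⁻¹))) ((1 : 𝔷) ⊗ₜ[k] t⁻¹) (genR' q p ⊗ₜ 1) := by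
  have hinv : (((genR q p)⁻¹ : (Hp q p)ˣ) : Hp q p) =
      genR' q p - algebraMap k (Hp q p) (q - q⁻¹) := rfl
  rw [Rspec, hinv, baxterize, Algebra.TensorProduct.one_def, algebraMap_smul_tmul_one,
    ← Algebra.algebraMap_eq_smul_one, ← IsScalarTower.algebraMap_apply, ← TensorProduct.sub_tmul,
    tmul_smul_tmul, one_smul, mul_one]
  rfl

variable (k 𝔷) in
/-- The map `𝔷(x) → 𝔷(x, y)` that sends the variable to `x` (for `i = 0`) or `y` (for `i = 1`). -/
def substZ (i : Fin 2) : Zx k 𝔷 →ₐ[𝔷] 𝔷 ⊗[k] Kxy k :=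
  Algebra.TensorProduct.map (AlgHom.id 𝔷 𝔷) (subst k i)

theorem evalAt_scal (i : Fin 2) (e : Zx k 𝔷) :
    evalAt q p i (scal q p e) = scalXY q p (substZ k 𝔷 i e) := by
  induction e using TensorProduct.induction_on with
  | zero => simp only [map_zero]
  | add e f he hf => simp only [map_add, he, hf]
  | tmul a f => simp [evalAt, scal, scalXY, substZ]

theorem evalAt_const (i : Fin 2) (h : Hp q p) : evalAt q p i (const q p h) = h ⊗ₜ 1 := by
  simp [evalAt, const]

theorem evalAt_smallFormula (n : ℕ) (A : ℕ → 𝔷) (s : 𝔷) (i : Fin 2) :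
    evalAt q (poly n A) i (smallFormula q n A s (Ktilde q n A)) =
      ((1 ⊗ₜ[k] var k i) * algebraMap 𝔷 (𝔷 ⊗[k] Kxy k) s) • (genK q (poly n A) ⊗ₜ[k] 1) +
      substZ k 𝔷 i (smallCoeff k (A 0 * s) (A 2)) • 1 + Ktilde q n A ⊗ₜ 1 := by
  have hs : substZ k 𝔷 i (s ⊗ₜ RatFunc.X) = 1 ⊗ₜ var k i * algebraMap 𝔷 (𝔷 ⊗[k] Kxy k) s := by
    simp [substZ, subst_X]
  rw [smallFormula_Ktilde, evalGenK_threeTermPoly, map_one, one_mul]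
  rw [map_add, map_add, map_mul, evalAt_scal, evalAt_scal, evalAt_const, evalAt_const, hs,
    scalXY_mul, ← scalXY_mul q _ (substZ k 𝔷 i _), mul_one]

theorem substZ_smallCoeff (i : Fin 2) (a₀ a₂ : 𝔷) :
    substZ k 𝔷 i (smallCoeff k a₀ a₂) * ((1 ⊗ₜ var k i) ^ 2 - 1) =
      (algebraMap 𝔷 _ a₀ + algebraMap 𝔷 _ a₂ * 1 ⊗ₜ var k i) * 1 ⊗ₜ var k i := by
  have hX : substZ k 𝔷 i (1 ⊗ₜ RatFunc.X) = 1 ⊗ₜ var k i := by simp [substZ, subst_X]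
  have h := congrArg (substZ k 𝔷 i) (smallCoeff_mul_sq_sub_one (k := k) a₀ a₂)
  simpa only [map_mul, map_sub, map_add, map_pow, map_one, AlgHom.commutes, hX] using h

theorem var_ne_zero (i : Fin 2) : var k i ≠ 0 := by
  rw [var]
  simp

theorem Ktilde_three (A : ℕ → 𝔷) : Ktilde q 3 A = genK q (poly 3 A) ^ 3 -
    A 0 • genK q (poly 3 A) ^ 2 - A 1 • genK q (poly 3 A) - A 2 • 1 := by
  simp only [Ktilde, Finset.sum_range_succ, Finset.sum_range_zero, Algebra.smul_def, zero_add,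
    Nat.add_one_sub_one, Nat.sub_zero, Nat.sub_self, pow_zero, pow_one, mul_one, sub_sub]

theorem smallFormula_isSolution {A : ℕ → 𝔷} {s : 𝔷} (hs : s ^ 2 = -A 3) :
    IsSolution q (poly 3 A) (smallFormula q 3 A s (Ktilde q 3 A)) := by
  have tmul_mul (f g : Kxy k) : (1 : 𝔷) ⊗ₜ[k] (f * g) = 1 ⊗ₜ f * 1 ⊗ₜ g :=
    map_mul (Algebra.TensorProduct.includeRight : Kxy k →ₐ[k] 𝔷 ⊗[k] Kxy k) f g
  have hvar (i : Fin 2) : (1 : 𝔷) ⊗ₜ[k] var k i * 1 ⊗ₜ (var k i)⁻¹ = 1 := by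
    rw [← tmul_mul, mul_inv_cancel₀ (var_ne_zero i), Algebra.TensorProduct.one_def]
  have hb (i : Fin 2) := substZ_smallCoeff (k := k) i (A 0 * s) (A 2)
  simp only [map_mul] at hb
  rw [IsSolution, Rspec_eq_baxterize, Rspec_eq_baxterize, evalAt_smallFormula,
    evalAt_smallFormula, inv_div, div_eq_inv_mul, mul_inv, tmul_mul, tmul_mul]
  refine reflection_threeTerm (A₁ := algebraMap 𝔷 _ (A 1)) (A₃ := algebraMap 𝔷 _ (A 3))
    ?_ ?_ ?_ ?_ (hvar 0) (hvar 1) ?_ (hb 0) (hb 1)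
  · rw [algebraMap_smul_tmul_one, Algebra.TensorProduct.tmul_mul_tmul, mul_one, ← sq, genR'_sq,
      TensorProduct.add_tmul, Algebra.smul_def, ← IsScalarTower.algebraMap_apply,
      Algebra.TensorProduct.one_def]
  · simp only [Algebra.TensorProduct.tmul_mul_tmul, genR'_mul_genK]
  · rw [Algebra.TensorProduct.tmul_mul_tmul, genK_mul_Ktilde, mul_one,
      Algebra.algebraMap_eq_smul_one, Algebra.TensorProduct.one_def, algebraMap_smul_tmul_one]
  · rw [Ktilde_three, Algebra.TensorProduct.tmul_pow, Algebra.TensorProduct.tmul_pow, one_pow,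
      one_pow, Algebra.TensorProduct.one_def]
    simp only [algebraMap_smul_tmul_one, TensorProduct.sub_tmul]
  · rw [← map_pow, hs, map_neg]

end ExplicitSolution

section Nontrivial

variable {k 𝔷 : Type*} [Field k] [CommRing 𝔷] [Algebra k 𝔷] {q : k} {n : ℕ}
  {A : ℕ → 𝔷}

variable (n A) in
/-- The commutative quotient of `𝓗_p` in which `R` becomes the scalar `q` and `K` a root of `p`;
it keeps `1, K, ..., K^(n-1), K̃` linearly independent. -/
def character (hq : q ≠ 0) : Hp q (poly n A) →ₐ[𝔷] RootAlg n (algebraMap 𝔷 (FieldXY 𝔷) ∘ A) :=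
  liftHp q (poly n A) (algebraMap k _ q) (root n (algebraMap 𝔷 (FieldXY 𝔷) ∘ A))
    (by
      rw [← map_pow, ← map_mul, ← map_one (algebraMap k _), ← map_add, sub_mul,
        inv_mul_cancel₀ hq, sub_add_cancel, sq])
    (by ring)
    (by
      rw [← Polynomial.aeval_map_algebraMap (FieldXY 𝔷), ← neg_neg (Polynomial.map _ _)]
      change Polynomial.aeval _ (-negPoly (poly n A)) = 0
      rw [negPoly_poly, neg_neg, aeval_root_poly])

theorem character_genK (hq : q ≠ 0) :
    character n A hq (genK q (poly n A)) = root n (algebraMap 𝔷 (FieldXY 𝔷) ∘ A) := by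
  rw [character, liftHp_genK]

theorem eq_zero_of_isTrivial_evalGenK_threeTermPoly [IsDomain 𝔷] (hq : q ≠ 0) (hn : 1 < n)
    {a b d : Zx k 𝔷}
    (h : IsTrivial q (poly n A)
      (evalGenK q (poly n A) (threeTermPoly n (algebraMap 𝔷 (Zx k 𝔷) ∘ A) a b d))) : d = 0 := by
  obtain ⟨f, hf⟩ := h
  have hchar := congrArg (extendScalars (character n A hq) ∘ evalAt q (poly n A) 0) hf
  rw [Function.comp_apply, Function.comp_apply, extendScalars_evalAt_evalGenK,
    extendScalars_evalAt_scal, character_genK, map_threeTermPoly, evalZx_comp_algebraMap_comp,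
    AdjoinRoot.aeval_eq, mk_threeTermPoly, Algebra.algebraMap_eq_smul_one] at hchar
  have hcoord := congrArg (tildeCoord n (algebraMap 𝔷 (FieldXY 𝔷) ∘ A)) hchar
  simp only [map_add, map_smul, tildeCoord_one n _ (by omega : 0 < n), tildeCoord_root n _ hn,
    tildeCoord_rootTilde, smul_eq_mul, mul_zero, zero_add, mul_one] at hcoord
  exact (map_eq_zero_iff _ (evalZx_injective k 𝔷 0)).1 hcoord

end Nontrivial

section SmallFormula

variable {k 𝔷 : Type*} [Field k] [CommRing 𝔷] [Algebra k 𝔷] {q : k}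

theorem smallFormula_isSmallSolution {A : ℕ → 𝔷} {s : 𝔷} (hs : s ^ 2 = -A 3) :
    IsSmallSolution q 3 A (smallFormula q 3 A s (Ktilde q 3 A)) := by
  refine ⟨smallFormula_isSolution q hs, by norm_num,
    fun j => if j = 0 then smallCoeff k (A 0 * s) (A 2) else if j = 1 then s ⊗ₜ RatFunc.X else 0,
    1, ?_, rfl⟩
  rw [← evalGenK_tildeComb, tildeComb_eq_threeTermPoly (by norm_num), smallFormula_Ktilde]
  · rfl
  · intro j hj _
    rw [if_neg (by omega), if_neg (by omega)]

theorem smallFormula_isNontrivialSmall [IsDomain 𝔷] (hq : q ≠ 0) {A : ℕ → 𝔷} {s : 𝔷}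
    (hs : s ^ 2 = -A 3) : IsNontrivialSmall q 3 A (smallFormula q 3 A s (Ktilde q 3 A)) := by
  refine ⟨smallFormula_isSmallSolution hs, fun h => ?_⟩
  rw [smallFormula_Ktilde] at h
  have : Nontrivial (Zx k 𝔷) := (evalZx k 𝔷 0).toRingHom.domain_nontrivial
  exact one_ne_zero (eq_zero_of_isTrivial_evalGenK_threeTermPoly hq (by norm_num) h)

theorem smul_inv_genK {n : ℕ} {A : ℕ → 𝔷} {u : (Hp q (poly n A))ˣ}
    (hu : u.val = genK q (poly n A)) : A n • u⁻¹.val = Ktilde q n A := by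
  rw [Algebra.smul_def, Algebra.commutes, ← genK_mul_Ktilde, ← hu, Units.inv_mul_cancel_left]

theorem const_smul (p : 𝔷[X]) (a : 𝔷) (h : Hp q p) :
    const q p (a • h) = scal q p (algebraMap 𝔷 (Zx k 𝔷) a) * const q p h := by
  simp [const, scal, Algebra.smul_def]

end SmallFormula

theorem sub_inv_ne_zero {k : Type*} [Field k] {q : k} (hq0 : q ≠ 0) (hq1 : q ≠ 1)
    (hq2 : q ≠ -1) : q - q⁻¹ ≠ 0 := by
  rw [sub_ne_zero, ne_eq, ← mul_eq_one_iff_eq_inv₀ hq0, mul_self_eq_one_iff, not_or]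
  exact ⟨hq1, hq2⟩

end Baxter

end

open Baxter in
theorem mainTheorem3_general {k 𝔷 : Type*} [Field k] (h2 : (2 : k) ≠ 0) [CommRing 𝔷] [IsDomain 𝔷]
    [Algebra k 𝔷] (q : k) (hq0 : q ≠ 0) (hq1 : q ≠ 1) (hq2 : q ≠ -1)
    (n : ℕ) (A : ℕ → 𝔷) (hA : (poly n A).eval 0 ≠ 0) :
    (∀ F : Hpx q (poly n A), IsNontrivialSmall q n A F → ∃ a b c : Zx k 𝔷,
        F = scal q (poly n A) a * const q (poly n A) (genK q (poly n A)) + scal q (poly n A) b +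
            scal q (poly n A) c * const q (poly n A) (Ktilde q n A)) ∧
    (∀ u : (Hp q (poly n A))ˣ, u.val = genK q (poly n A) →
      ∀ F : Hpx q (poly n A), IsNontrivialSmall q n A F → ∃ a b c : Zx k 𝔷,
        F = scal q (poly n A) a * const q (poly n A) (genK q (poly n A)) + scal q (poly n A) b +
            scal q (poly n A) c * const q (poly n A) u⁻¹.val) ∧
    ((∃ F : Hpx q (poly n A), IsNontrivialSmall q n A F) → n = 3) ∧
    (n = 3 → ∀ s : 𝔷, s ^ 2 = -A 3 →
      IsNontrivialSmall q n A (smallFormula q n A s (Ktilde q n A)) ∧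
      (∀ F : Hpx q (poly n A), IsNontrivialSmall q n A F → ∃ f : Zx k 𝔷,
        F = scal q (poly n A) f * smallFormula q n A s (Ktilde q n A) ∨
        F = scal q (poly n A) f * smallFormula q n A (-s) (Ktilde q n A)) ∧
      (∀ u : (Hp q (poly n A))ˣ, u.val = genK q (poly n A) →
        IsNontrivialSmall q n A (smallFormula q n A s (A 3 • u⁻¹.val)) ∧
        ∀ F : Hpx q (poly n A), IsNontrivialSmall q n A F → ∃ f : Zx k 𝔷,
          F = scal q (poly n A) f * smallFormula q n A s (A 3 • u⁻¹.val) ∨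
          F = scal q (poly n A) f * smallFormula q n A (-s) (A 3 • u⁻¹.val))) := by
  rw [poly_eval_zero] at hA
  have hq := sub_inv_ne_zero hq0 hq1 hq2
  have shape {F : Hpx q (poly n A)} (hF : IsNontrivialSmall q n A F) : ∃ a b c : Zx k 𝔷,
      F = scal q (poly n A) a * const q (poly n A) (genK q (poly n A)) + scal q (poly n A) b +
        scal q (poly n A) c * const q (poly n A) (Ktilde q n A) := by
    obtain ⟨a, b, c, -, hF⟩ := hF.1.exists_eq_evalGenK_threeTermPoly h2 hq
    exact ⟨a, b, c, hF.trans (evalGenK_threeTermPoly q n A a b c)⟩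
  refine ⟨fun F => shape, fun u hu F hF => ?_, fun ⟨F, hF⟩ => hF.eq_three h2 hq hA, ?_⟩
  · obtain ⟨a, b, c, rfl⟩ := shape hF
    refine ⟨a, b, c * algebraMap 𝔷 _ (A n), ?_⟩
    rw [← smul_inv_genK hu, const_smul, map_mul, mul_assoc (scal q _ c)]
  · rintro rfl s hs
    have existence := smallFormula_isNontrivialSmall hq0 hs
    have uniqueness (F) (hF : IsNontrivialSmall q 3 A F) :=
      hF.eq_scal_mul_smallFormula h2 hq hA hs
    refine ⟨existence, uniqueness, fun u hu => ?_⟩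
    rw [smul_inv_genK hu]
    exact ⟨existence, uniqueness⟩

theorem mainTheorem3 {k 𝔷 : Type*} [Field k] [CharZero k] [CommRing 𝔷] [IsDomain 𝔷]
    [Algebra k 𝔷] (q : k) (hq0 : q ≠ 0) (hq1 : q ≠ 1) (hq2 : q ≠ -1)
    (n : ℕ) (hn : 1 ≤ n) (A : ℕ → 𝔷) (hA : (Baxter.poly n A).eval 0 ≠ 0) :
    -- the shape of a non-trivial small solution, with `K̃` in the role of `A_n K⁻¹`
    (∀ F : Baxter.Hpx q (Baxter.poly n A), Baxter.IsNontrivialSmall q n A F →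
      ∃ a b c : Baxter.Zx k 𝔷,
        F = Baxter.scal q (Baxter.poly n A) a *
              Baxter.const q (Baxter.poly n A) (Baxter.genK q (Baxter.poly n A)) +
            Baxter.scal q (Baxter.poly n A) b +
            Baxter.scal q (Baxter.poly n A) c *
              Baxter.const q (Baxter.poly n A) (Baxter.Ktilde q n A)) ∧
    -- the same with `K⁻¹`, when `K` is invertible
    (∀ u : (Baxter.Hp q (Baxter.poly n A))ˣ, u.val = Baxter.genK q (Baxter.poly n A) →
      ∀ F : Baxter.Hpx q (Baxter.poly n A), Baxter.IsNontrivialSmall q n A F →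
      ∃ a b c : Baxter.Zx k 𝔷,
        F = Baxter.scal q (Baxter.poly n A) a *
              Baxter.const q (Baxter.poly n A) (Baxter.genK q (Baxter.poly n A)) +
            Baxter.scal q (Baxter.poly n A) b +
            Baxter.scal q (Baxter.poly n A) c *
              Baxter.const q (Baxter.poly n A) u⁻¹.val) ∧
    -- a non-trivial small solution exists only for `n = 3`
    ((∃ F : Baxter.Hpx q (Baxter.poly n A), Baxter.IsNontrivialSmall q n A F) → n = 3) ∧
    -- for `n = 3`: the explicit solution, and its uniqueness up to a factor and the choice of
    -- the square root `s` of `-A_3`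
    (n = 3 → ∀ s : 𝔷, s ^ 2 = -A 3 →
      Baxter.IsNontrivialSmall q n A (Baxter.smallFormula q n A s (Baxter.Ktilde q n A)) ∧
      (∀ F : Baxter.Hpx q (Baxter.poly n A), Baxter.IsNontrivialSmall q n A F →
        ∃ f : Baxter.Zx k 𝔷,
          F = Baxter.scal q (Baxter.poly n A) f *
                Baxter.smallFormula q n A s (Baxter.Ktilde q n A) ∨
          F = Baxter.scal q (Baxter.poly n A) f *
                Baxter.smallFormula q n A (-s) (Baxter.Ktilde q n A)) ∧
      (∀ u : (Baxter.Hp q (Baxter.poly n A))ˣ, u.val = Baxter.genK q (Baxter.poly n A) →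
        Baxter.IsNontrivialSmall q n A (Baxter.smallFormula q n A s (A 3 • u⁻¹.val)) ∧
        ∀ F : Baxter.Hpx q (Baxter.poly n A), Baxter.IsNontrivialSmall q n A F →
          ∃ f : Baxter.Zx k 𝔷,
            F = Baxter.scal q (Baxter.poly n A) f *
                  Baxter.smallFormula q n A s (A 3 • u⁻¹.val) ∨
            F = Baxter.scal q (Baxter.poly n A) f *
                  Baxter.smallFormula q n A (-s) (A 3 • u⁻¹.val))) :=
  mainTheorem3_general two_ne_zero q hq0 hq1 hq2 n A hA
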